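/- **Theorem.** The synthesis problem for games on full-information protocols (FIP games) with one active player, any number of passive observers and a visible parity winning condition is decidable. *FIP games.* The players are $I=\{0,1,\dots,n\}$ for some $n\ge 0$; Player $0$ is the active player and the players $1,\dots,n$ are observers. A game consists of finite nonempty sets $A$ (actions of Player $0$), $\Gamma$ (moves) and $\Sigma$ (observations), a map $\mathrm{act}:\Gamma\to A$, a Mealy automaton for each $i\in I$ defining an observation function $\beta_i:\Gamma^+\to\Sigma$, relations $R_\sigma\subseteq I\times I$ for $\sigma\in\Sigma$ (where $(i,j)\in R_\sigma$ means that Player $i$ receives the whole view of Player $j$ whenever $i$ observes $\sigma$), and a Mealy automaton defining a colouring $\lambda:\Gamma^+\to\mathbb N$ with priorities. Here a Mealy automaton with finite state set $Q$, initial state $q_\varepsilon$, transition function $\delta$ and output function $o$ on $Q\times\Gamma$ defines the function $\tau c\mapsto o(\delta(q_\varepsilon,\tau),c)$, for $\tau\in\Gamma^*$ and $c\in\Gamma$; on the empty word $\varepsilon$ the functions $\beta_i$ and $\lambda$ produce no symbol, and this counts as a common value. For a history $\tau=c_1\cdots c_\ell\in\Gamma^*$ write $\tau(t)=c_1\cdots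 c_t$. The view graph of $\tau$ has the nodes $I\times\{0,\dots,\ell\}$ and the edges $(i,t)\to(i,t-1)$ for $i \in I$, $1<t\le\ell$, and $(i,t)\to(j,t)$ for $i,j\in I$, $1\le t\le\ell$ with $(i,j)\in R_{\beta_i(\tau(t))}$. Histories $\tau,\tau'$ are indistinguishable for Player $i$, written $\tau\sim_i\tau'$, if $|\tau|=|\tau'|$ and $\beta_j(\tau(t))=\beta_j(\tau'(t))$ for every node $(j,t)$ reachable from $(i,|\tau|)$ in the view graph of $\tau$. Such a game is a FIP game with visible winning condition if * (visible actions) $\mathrm{act}(c)\ne\mathrm{act}(c')$ implies $\beta_0(\tau c)\neq\beta_0(\tau'c')$ for all $\tau,\tau'\in\Gamma^*$ and $c,c'\in\Gamma$; * (visible winning condition) $\tau\sim_0\tau'$ implies $\lambda(\tau)=\lambda(\tau')$. A strategy is a map $s:\Gamma^*\to A$ such that $\tau\sim_0\tau'$ implies $s(\tau)=s(\tau')$. A play $c_1c_2\cdots\in\Gamma^\omega$ follows $s$ if $\mathrm{act}(c_t)=s(c_1\cdots c_{t-1})$ for all $t\ge1$. The strategy is winning if every play $c_1c_2\cdots$ that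 follows it satisfies the parity condition: $\liminf_{t\to\infty}\lambda(c_1\cdots c_t)$ is even. *Claim.* There is an algorithm that, given a finite description of such data (the numbers of players, actions, moves and observations, the map $\mathrm{act}$, the transition and output tables of the Mealy automata, and the relations $R_\sigma$), decides whether they form a FIP game with visible winning condition in which Player $0$ has a winning strategy. In particular, given a FIP game with visible parity winning condition, it is decidable whether a winning strategy exists. -/

import Mathlib

namespace FIP

/-- A Mealy automaton over the input alphabet `Γ` with output alphabet `S`. -/
structure Mealy (Γ S : Type) where
  /-- the set of states -/
  State : Type
  /-- the set of states is finite -/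
  finite : Finite State
  /-- the initial state -/
  init : State
  /-- the transition function -/
  step : State → Γ → State
  /-- the output function on states and letters -/
  out : State → Γ → S

namespace Mealy

variable {Γ S : Type}

/-- The state reached from the initial state on a finite word. -/
def run (M : Mealy Γ S) (τ : List Γ) : M.State :=
  τ.foldl M.step M.init

/-- The function on words defined by a Mealy automaton: a nonempty word `τ c` is sent to the output
symbol `out (run τ) c`; the empty word produces no symbol (`none`). -/
def fn (M : Mealy Γ S) (τ : List Γ) : Option S :=
  τ.getLast?.map fun c => M.out (M.run τ.dropLast) c

theorem fn_nil (M : Mealy Γ S) : M.fn [] = none := rfl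

theorem fn_append_singleton (M : Mealy Γ S) (τ : List Γ) (c : Γ) :
    M.fn (τ ++ [c]) = some (M.out (M.run τ) c) := by
  simp [fn]

end Mealy

/-- The prefix `c₁ c₂ … c_t` of length `t` of a play; here `π k` is the move `c_{k+1}`. -/
def playPrefix {Γ : Type} (π : ℕ → Γ) (t : ℕ) : List Γ :=
  (List.range t).map π

/-- The output sequence of a Mealy automaton on an infinite word `c₁ c₂ …`; its entry at `t` is the
output of the prefix `c₁ … c_{t+1}`. -/
def Mealy.trace {Γ S : Type} (M : Mealy Γ S) (π : ℕ → Γ) (t : ℕ) : S :=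
  M.out (M.run (playPrefix π t)) (π t)

/-- The trace lists the values of `Mealy.fn` on the nonempty prefixes. -/
theorem Mealy.fn_playPrefix_succ {Γ S : Type} (M : Mealy Γ S) (π : ℕ → Γ) (t : ℕ) :
    M.fn (playPrefix π (t + 1)) = some (M.trace π t) := by
  have h : playPrefix π (t + 1) = playPrefix π t ++ [π t] := by
    simp [playPrefix, List.range_succ]
  rw [h, Mealy.fn_append_singleton]
  rfl

/-- The parity condition on a sequence of priorities: its limit inferior, which is the least priority
that occurs infinitely often, exists in `ℕ` and is even. -/
def ParityCondition (u : ℕ → ℕ) : Prop :=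
  ∃ p : ℕ, Even p ∧ (∀ᶠ t in Filter.atTop, p ≤ u t) ∧ (∃ᶠ t in Filter.atTop, u t = p)

/-- On bounded sequences of priorities the parity condition says that the limit inferior is even. -/
theorem parityCondition_iff_liminf {u : ℕ → ℕ} (hu : BddAbove (Set.range u)) :
    ParityCondition u ↔ Even (Filter.liminf u Filter.atTop) := by
  have key : ∀ p : ℕ, (∀ᶠ t in Filter.atTop, p ≤ u t) → (∃ᶠ t in Filter.atTop, u t = p) →
      Filter.liminf u Filter.atTop = p := by
    intro p h1 h2
    rw [Filter.liminf_eq]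
    refine IsGreatest.csSup_eq ⟨h1, fun a ha => ?_⟩
    obtain ⟨t, ht, ht'⟩ := (h2.and_eventually ha).exists
    exact ht ▸ ht'
  constructor
  · rintro ⟨p, hp, h1, h2⟩
    rwa [key p h1 h2]
  · intro h
    obtain ⟨B, hB⟩ := hu
    have hne : ∃ p : ℕ, ∃ᶠ t in Filter.atTop, u t = p := by
      by_contra hcon
      push Not at hcon
      have hall : ∀ᶠ t in Filter.atTop, ∀ p ∈ Finset.range (B + 1), u t ≠ p :=
        (Filter.eventually_all_finset _).2 fun p _ => hcon p
      obtain ⟨t, ht⟩ := hall.exists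
      exact ht (u t) (Finset.mem_range.2 (Nat.lt_succ_of_le (hB ⟨t, rfl⟩))) rfl
    classical
    have hmin := Nat.find_spec hne
    have hev : ∀ᶠ t in Filter.atTop, Nat.find hne ≤ u t := by
      have hall : ∀ᶠ t in Filter.atTop, ∀ p ∈ Finset.range (Nat.find hne), u t ≠ p :=
        (Filter.eventually_all_finset _).2 fun p hp => by
          have := Nat.find_min hne (Finset.mem_range.1 hp)
          simpa [Filter.Frequently] using this
      filter_upwards [hall] with t ht
      by_contra hlt
      exact ht (u t) (Finset.mem_range.2 (not_le.1 hlt)) rfl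
    refine ⟨Nat.find hne, ?_, hev, hmin⟩
    rwa [key _ hev hmin] at h

/-- The data of a game on a full-information protocol with players `0, …, n` (Player `0` is the
active player, the players `1, …, n` are the observers), action set `A` of Player `0`, move alphabet
`Γ` and observation alphabet `S`. The two conditions imposed on such data are `ActionVisible` and
`ColorVisible` below. -/
structure Game (n : ℕ) (A Γ S : Type) where
  /-- the action that supports a move -/
  act : Γ → A
  /-- the Mealy automaton defining the observation function of each player -/
  obs : Fin (n + 1) → Mealy Γ S
  /-- `link σ i j` is the relation `(i, j) ∈ R_σ`: on receiving observation `σ`, Player `i` also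
  receives the entire view of Player `j` -/
  link : S → Fin (n + 1) → Fin (n + 1) → Prop
  /-- the Mealy automaton defining the priorities of nonempty histories -/
  color : Mealy Γ ℕ

namespace Game

variable {n : ℕ} {A Γ S : Type} (G : Game n A Γ S)

/-- The edges of the view graph of a history `τ`. A node `(i, t)` is the viewpoint of Player `i` after
`t` rounds. -/
inductive ViewEdge (τ : List Γ) : Fin (n + 1) × ℕ → Fin (n + 1) × ℕ → Prop
  /-- looking into the past -/
  | past (i : Fin (n + 1)) (t : ℕ) : 1 < t → t ≤ τ.length → ViewEdge τ (i, t) (i, t - 1)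
  /-- communication along a direct link -/
  | comm (i j : Fin (n + 1)) (t : ℕ) (σ : S) : 1 ≤ t → t ≤ τ.length →
      (G.obs i).fn (τ.take t) = some σ → G.link σ i j → ViewEdge τ (i, t) (j, t)

/-- The histories `τ` and `τ'` are indistinguishable for Player `i`. -/
def Indist (i : Fin (n + 1)) (τ τ' : List Γ) : Prop :=
  τ.length = τ'.length ∧
    ∀ (j : Fin (n + 1)) (t : ℕ),
      Relation.ReflTransGen (G.ViewEdge τ) (i, τ.length) (j, t) →
        (G.obs j).fn (τ.take t) = (G.obs j).fn (τ'.take t)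

/-- Moves with different actions always come with different observations of Player `0`. -/
def ActionVisible : Prop :=
  ∀ c c' : Γ, G.act c ≠ G.act c' →
    ∀ τ τ' : List Γ, (G.obs 0).fn (τ ++ [c]) ≠ (G.obs 0).fn (τ' ++ [c'])

/-- The winning condition is visible: the priority is constant on every information set of
Player `0`. -/
def ColorVisible : Prop :=
  ∀ τ τ' : List Γ, G.Indist 0 τ τ' → G.color.fn τ = G.color.fn τ'

/-- A strategy (of Player `0`) is an information-consistent decision function. -/
def IsStrategy (s : List Γ → A) : Prop :=
  ∀ τ τ' : List Γ, G.Indist 0 τ τ' → s τ = s τ'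

/-- The play `π` follows the decision function `s`. -/
def Follows (π : ℕ → Γ) (s : List Γ → A) : Prop :=
  ∀ t : ℕ, G.act (π t) = s (playPrefix π t)

/-- The play `π` satisfies the parity winning condition induced by the colouring. -/
def WinningPlay (π : ℕ → Γ) : Prop :=
  ParityCondition (G.color.trace π)

/-- Player `0` has a winning strategy. -/
def HasWinningStrategy : Prop :=
  ∃ s : List Γ → A, G.IsStrategy s ∧ ∀ π : ℕ → Γ, G.Follows π s → G.WinningPlay π

end Game

/-- A finite description of a Mealy automaton. The states are `0, …, maxState`, and
the entry of `table` in row `q` and column `c` is the pair (next state, output symbol). -/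
structure MealyCode where
  /-- the largest state -/
  maxState : ℕ
  /-- the initial state -/
  init : ℕ
  /-- the transition and output table -/
  table : List (List (ℕ × ℕ))

/-- The entry in row `q` and column `c` of the table (missing entries count as `(0, 0)`). -/
def MealyCode.entry (M : MealyCode) (q c : ℕ) : ℕ × ℕ :=
  (M.table.getD q []).getD c (0, 0)

/-- The Mealy automaton with input alphabet `{0, …, m}` described by a code. State numbers are read
modulo the number of states, and `g` interprets the output symbols. -/
def MealyCode.toMealy (M : MealyCode) (m : ℕ) {S : Type} (g : ℕ → S) : Mealy (Fin (m + 1)) S where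
  State := Fin (M.maxState + 1)
  finite := inferInstance
  init := Fin.ofNat (M.maxState + 1) M.init
  step q c := Fin.ofNat (M.maxState + 1) (M.entry q c).1
  out q c := g (M.entry q c).2

/-- A finite description of a game on a full-information protocol: the input of the synthesis
problem. The players are `0, …, observers`, the actions `0, …, maxAction`, the moves
`0, …, maxMove` and the observations `0, …, maxObs`. -/
structure GameCode where
  /-- the number of observers -/
  observers : ℕ
  /-- the largest action -/
  maxAction : ℕ
  /-- the largest move -/
  maxMove : ℕ
  /-- the largest observation symbol -/
  maxObs : ℕ
  /-- the list of the actions of the moves -/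
  act : List ℕ
  /-- the list of the observation automata of the players -/
  obs : List MealyCode
  /-- the list of all triples `(σ, i, j)` with `(i, j) ∈ R_σ` -/
  links : List (ℕ × ℕ × ℕ)
  /-- the automaton of the colouring function -/
  color : MealyCode

/-- The game described by a code. Numbers of actions, observations and states are read modulo the
sizes of the respective sets, so that every code describes a game; every finite game with nonempty
move alphabet is described by some code, up to the naming of its elements. -/
def GameCode.game (c : GameCode) :
    Game c.observers (Fin (c.maxAction + 1)) (Fin (c.maxMove + 1)) (Fin (c.maxObs + 1)) where
  act x := Fin.ofNat (c.maxAction + 1) (c.act.getD x 0)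
  obs i := (c.obs.getD i ⟨0, 0, []⟩).toMealy c.maxMove (Fin.ofNat (c.maxObs + 1))
  link σ i j := ((σ : ℕ), (i : ℕ), (j : ℕ)) ∈ c.links
  color := c.color.toMealy c.maxMove id

/-- A code of an automaton as a tuple. -/
def mealyCodeEquiv : MealyCode ≃ ℕ × ℕ × List (List (ℕ × ℕ)) where
  toFun M := (M.maxState, M.init, M.table)
  invFun x := ⟨x.1, x.2.1, x.2.2⟩
  left_inv _ := rfl
  right_inv _ := rfl

instance : Primcodable MealyCode := Primcodable.ofEquiv _ mealyCodeEquiv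

/-- A code of a game as a tuple. -/
def gameCodeEquiv : GameCode ≃
    (ℕ × ℕ × ℕ × ℕ) × List ℕ × List MealyCode × List (ℕ × ℕ × ℕ) × MealyCode where
  toFun c := ((c.observers, c.maxAction, c.maxMove, c.maxObs), c.act, c.obs, c.links, c.color)
  invFun x := ⟨x.1.1, x.1.2.1, x.1.2.2.1, x.1.2.2.2, x.2.1, x.2.2.1, x.2.2.2.1, x.2.2.2.2⟩
  left_inv _ := rfl
  right_inv _ := rfl

instance : Primcodable GameCode := Primcodable.ofEquiv _ gameCodeEquiv

/-- The code describes a FIP game with a visible (parity) winning condition. -/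
def GameCode.IsVisibleFIPGame (c : GameCode) : Prop :=
  c.game.ActionVisible ∧ c.game.ColorVisible


theorem getD_ofFn {α : Type} {k : ℕ} (f : Fin (k + 1) → α) (i : Fin (k + 1)) (d : α) :
    (List.ofFn f).getD (i : ℕ) d = f i := by
  rw [List.getD_eq_getElem _ _ (by simp; omega)]
  exact List.getElem_ofFn ..

/-- Every finite automaton is described by some code. -/
theorem MealyCode.exists_fn_eq {m : ℕ} {S : Type} (M : Mealy (Fin (m + 1)) S) (g : ℕ → S)
    (hg : Function.Surjective g) : ∃ c : MealyCode, ∀ τ, (c.toMealy m g).fn τ = M.fn τ := by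
  classical
  have := M.finite
  have : Nonempty M.State := ⟨M.init⟩
  obtain ⟨k, ⟨e⟩⟩ := Finite.exists_equiv_fin M.State
  obtain ⟨k, rfl⟩ : ∃ k', k = k' + 1 :=
    Nat.exists_eq_succ_of_ne_zero fun h => by subst h; exact (e M.init).elim0
  choose r hr using hg
  let c : MealyCode := ⟨k, e M.init, List.ofFn fun q : Fin (k + 1) => List.ofFn fun x : Fin (m + 1) =>
    ((e (M.step (e.symm q) x) : ℕ), r (M.out (e.symm q) x))⟩
  have hentry : ∀ (q : Fin (k + 1)) (x : Fin (m + 1)),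
      c.entry q x = ((e (M.step (e.symm q) x) : ℕ), r (M.out (e.symm q) x)) := by
    intro q x
    simp only [c, MealyCode.entry, getD_ofFn]
  have hrun : ∀ τ, (c.toMealy m g).run τ = e (M.run τ) := by
    intro τ
    induction τ using List.reverseRecOn with
    | nil => exact Fin.ofNat_val_eq_self _
    | append_singleton τ x ih =>
      simp only [Mealy.run, List.foldl_append, List.foldl_cons, List.foldl_nil] at ih ⊢
      rw [ih]
      change Fin.ofNat (k + 1) (c.entry _ _).1 = _
      rw [hentry]
      simp
  refine ⟨c, fun τ => ?_⟩
  rcases List.eq_nil_or_concat τ with rfl | ⟨τ, x, rfl⟩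
  · rfl
  · rw [List.concat_eq_append, Mealy.fn_append_singleton, Mealy.fn_append_singleton, hrun]
    change some (g (c.entry _ _).2) = _
    rw [hentry]
    simp [hr]

/-- Every game on finite sets is described by some code. -/
theorem GameCode.exists_game {n a m s : ℕ} (G : Game n (Fin (a + 1)) (Fin (m + 1)) (Fin (s + 1))) :
    ∃ (act : List ℕ) (obs : List MealyCode) (links : List (ℕ × ℕ × ℕ)) (color : MealyCode),
      let G' := GameCode.game ⟨n, a, m, s, act, obs, links, color⟩
      G'.act = G.act ∧ (∀ i τ, (G'.obs i).fn τ = (G.obs i).fn τ) ∧ G'.link = G.link ∧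
        ∀ τ, G'.color.fn τ = G.color.fn τ := by
  classical
  choose o ho using fun i => MealyCode.exists_fn_eq (G.obs i) (Fin.ofNat (s + 1))
    (fun x => ⟨x, Fin.ofNat_val_eq_self _⟩)
  obtain ⟨col, hcol⟩ := MealyCode.exists_fn_eq G.color id Function.surjective_id
  refine ⟨List.ofFn fun x => (G.act x : ℕ), List.ofFn o,
    ((Finset.univ.filter fun x : Fin (s + 1) × Fin (n + 1) × Fin (n + 1) =>
      G.link x.1 x.2.1 x.2.2).toList.map fun x => ((x.1 : ℕ), (x.2.1 : ℕ), (x.2.2 : ℕ))), col,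
    ?_, ?_, ?_, hcol⟩
  · funext x
    exact (congrArg (Fin.ofNat (a + 1)) (getD_ofFn _ x 0)).trans (Fin.ofNat_val_eq_self _)
  · intro i τ
    rw [← ho, ← getD_ofFn o i ⟨0, 0, []⟩]
    rfl
  · funext σ i j
    simp [GameCode.game]
    constructor
    · rintro ⟨σ', i', j', h, h1, h2, h3⟩
      rw [← Fin.ext h1, ← Fin.ext h2, ← Fin.ext h3]; exact h
    · intro h; exact ⟨σ, i, j, h, rfl, rfl, rfl⟩

end FIP

namespace FIP

/-! Indistinguishability is extended from single players to sets `J` of players. By `sim_append`,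
two nonempty histories are indistinguishable for `J` exactly when their last observations agree on
the set `K` of players reached from `J` along the currently active links, and the histories without
their last moves are indistinguishable for `K`. Since `J ⊆ K`, going back in time only enlarges the
set of players, so the nesting of knowledge is bounded by the finite lattice of sets of players.

This permits finite types, defined from the largest set downwards: the type of a history at `J`
records, for all histories indistinguishable from it for `J`, the joint automaton state and the
types at strictly larger sets (`exists_types`). The joint state together with all types is updated
deterministically by each move, which yields a finite automaton (`exists_abstraction`). Its
correctness is captured by the local conditions `Abstraction.Valid`; they alone imply that
indistinguishable histories have equal types, and that equality of types is realised by
indistinguishable histories (`type_eq_of_sim`, `exists_sim`).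

The types at `{0}` are the positions of a finite parity game with perfect information: Player `0`
picks an action, and Nature picks any state of the current type and a move supported by the action.
This game is positionally determined, with strategies witnessed by ranks (`parity_determined`,
`exists_positional_strategy`). A win of Player `0` is a strategy in the original game, because types
are invariant under indistinguishability. If Nature wins, then its answers to a given strategy form
a sequence of histories that need not extend each other; Kőnig's lemma supplies an actual play whose
prefixes are indistinguishable from them. Visible actions make this play follow the strategy, and
visible priorities make it losing (`EnvWins.not_hasWinningStrategy`).

For decidability no size bound is needed. A certificate tabulates an abstraction and a positional
strategy of one of the sides; checking it is primitive recursive, positive and negative certificates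
are sound, and every code has one of the two (`exists_cYes_or_cNo`). An unbounded search therefore
decides the problem. -/

theorem Mealy.run_append_singleton {Γ S : Type} (M : Mealy Γ S) (τ : List Γ) (c : Γ) :
    M.run (τ ++ [c]) = M.step (M.run τ) c := by
  simp [Mealy.run]

/-! ### Indistinguishability of histories for sets of players. -/

namespace Game

open Relation

variable {n : ℕ} {A Γ S : Type} (G : Game n A Γ S)

/-- The joint states of all automata of a game. -/
abbrev Joint : Type := (∀ i, (G.obs i).State) × G.color.State

/-- The joint state reached on a history. -/
def jrun (τ : List Γ) : G.Joint := (fun i => (G.obs i).run τ, G.color.run τ)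

/-- The transition function on joint states. -/
def jstep (q : G.Joint) (c : Γ) : G.Joint := (fun i => (G.obs i).step (q.1 i) c, G.color.step q.2 c)

theorem jrun_append (τ : List Γ) (c : Γ) : G.jrun (τ ++ [c]) = G.jstep (G.jrun τ) c := by
  simp [jrun, jstep, Mealy.run_append_singleton]

/-- The observations of the players on a move at a joint state. -/
def ob (q : G.Joint) (c : Γ) (i : Fin (n + 1)) : S := (G.obs i).out (q.1 i) c

/-- The priority of a move at a joint state. -/
def pri (q : G.Joint) (c : Γ) : ℕ := G.color.out q.2 c

theorem obs_fn_append (τ : List Γ) (c : Γ) (i : Fin (n + 1)) :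
    (G.obs i).fn (τ ++ [c]) = some (G.ob (G.jrun τ) c i) :=
  Mealy.fn_append_singleton ..

theorem color_fn_append (τ : List Γ) (c : Γ) :
    G.color.fn (τ ++ [c]) = some (G.pri (G.jrun τ) c) :=
  Mealy.fn_append_singleton ..

/-- The players that are reached from a set of players along the links of an observation profile. -/
def cl (o : Fin (n + 1) → S) (J : Set (Fin (n + 1))) : Set (Fin (n + 1)) :=
  {k | ∃ j ∈ J, ReflTransGen (fun i k => G.link (o i) i k) j k}

variable {G}

theorem subset_cl (o : Fin (n + 1) → S) (J : Set (Fin (n + 1))) : J ⊆ G.cl o J :=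
  fun j hj => ⟨j, hj, .refl⟩

theorem cl_mono (o : Fin (n + 1) → S) {J J' : Set (Fin (n + 1))} (h : J ⊆ J') :
    G.cl o J ⊆ G.cl o J' :=
  fun _ ⟨j, hj, hk⟩ => ⟨j, h hj, hk⟩

theorem cl_closed {o : Fin (n + 1) → S} {J : Set (Fin (n + 1))} {i k : Fin (n + 1)}
    (hi : i ∈ G.cl o J) (h : G.link (o i) i k) : k ∈ G.cl o J := by
  obtain ⟨j, hj, hji⟩ := hi
  exact ⟨j, hj, hji.tail h⟩

theorem cl_subset {o : Fin (n + 1) → S} {J K : Set (Fin (n + 1))} (hJ : J ⊆ K)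
    (hK : ∀ i ∈ K, ∀ k, G.link (o i) i k → k ∈ K) : G.cl o J ⊆ K := by
  rintro k ⟨j, hj, hk⟩
  induction hk with
  | refl => exact hJ hj
  | tail _ h ih => exact hK _ ih _ h

/-- The closure depends only on the observations of the players it contains, so agreement on it
makes each of the two sets closed under the other's links. -/
theorem cl_congr {o o' : Fin (n + 1) → S} {J : Set (Fin (n + 1))}
    (h : ∀ k ∈ G.cl o J, o k = o' k) : G.cl o' J = G.cl o J := by
  have h1 : G.cl o' J ⊆ G.cl o J :=
    cl_subset (subset_cl o J) fun i hi k hk => cl_closed hi (by rwa [h i hi])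
  refine h1.antisymm (cl_subset (subset_cl o' J) fun i hi k hk => cl_closed hi ?_)
  rwa [← h i (h1 hi)]

theorem ViewEdge.append {τ : List Γ} {c : Γ} {a b : Fin (n + 1) × ℕ} (h : G.ViewEdge τ a b) :
    G.ViewEdge (τ ++ [c]) a b := by
  cases h with
  | past i t h1 h2 => exact .past i t h1 (by simp; omega)
  | comm i j t σ h1 h2 h3 h4 =>
    exact .comm i j t σ h1 (by simp; omega) (by rwa [List.take_append_of_le_length h2]) h4

theorem ViewEdge.of_append {τ : List Γ} {c : Γ} {a b : Fin (n + 1) × ℕ}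
    (h : G.ViewEdge (τ ++ [c]) a b) (ha : a.2 ≤ τ.length) : G.ViewEdge τ a b := by
  cases h with
  | past i t h1 h2 => exact .past i t h1 ha
  | comm i j t σ h1 h2 h3 h4 =>
    exact .comm i j t σ h1 ha (by rwa [List.take_append_of_le_length ha] at h3) h4

theorem ViewEdge.le {τ : List Γ} {a b : Fin (n + 1) × ℕ} (h : G.ViewEdge τ a b) : b.2 ≤ a.2 := by
  cases h <;> simp

theorem reach_le {τ : List Γ} {a b : Fin (n + 1) × ℕ} (h : ReflTransGen (G.ViewEdge τ) a b) :
    b.2 ≤ a.2 := by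
  induction h with
  | refl => exact le_rfl
  | tail _ h ih => exact h.le.trans ih

/-- A path from the last round first follows communication edges, which sweeps out the closure, and
may then step once into the past; from there on the last move plays no role. Round 1 has no edge
into the past, which accounts for `0 < τ.length`. -/
theorem reach_append_iff {τ : List Γ} {c : Γ} {J : Set (Fin (n + 1))} {k : Fin (n + 1)} {t : ℕ} :
    (∃ j ∈ J, ReflTransGen (G.ViewEdge (τ ++ [c])) (j, (τ ++ [c]).length) (k, t)) ↔
      (t = τ.length + 1 ∧ k ∈ G.cl (G.ob (G.jrun τ) c) J) ∨
      (0 < τ.length ∧ ∃ j ∈ G.cl (G.ob (G.jrun τ) c) J,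
        ReflTransGen (G.ViewEdge τ) (j, τ.length) (k, t)) := by
  set o := G.ob (G.jrun τ) c with ho
  constructor
  · rintro ⟨j, hj, h⟩
    have key : ∀ b, ReflTransGen (G.ViewEdge (τ ++ [c])) (j, (τ ++ [c]).length) b →
        (b.2 = τ.length + 1 ∧ b.1 ∈ G.cl o J) ∨
        (0 < τ.length ∧ ∃ j ∈ G.cl o J, ReflTransGen (G.ViewEdge τ) (j, τ.length) b) := by
      intro b hb
      induction hb with
      | refl => exact .inl ⟨by simp, subset_cl o J hj⟩
      | @tail b d _ h ih =>
        rcases ih with ⟨h1, h2⟩ | ⟨h0, i, hi, hib⟩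
        · cases h with
          | past i t h3 h4 =>
            simp only at h1 h2
            subst h1
            exact .inr ⟨by omega, i, h2, .refl⟩
          | comm i j t σ h3 h4 h5 h6 =>
            simp only at h1 h2
            subst h1
            refine .inl ⟨rfl, cl_closed h2 ?_⟩
            rw [List.take_of_length_le (by simp), obs_fn_append] at h5
            rwa [← Option.some.inj h5] at h6
        · exact .inr ⟨h0, i, hi, hib.tail (h.of_append (reach_le hib))⟩
    exact key _ h
  · have key : ∀ k ∈ G.cl o J, ∃ j ∈ J,
        ReflTransGen (G.ViewEdge (τ ++ [c])) (j, (τ ++ [c]).length) (k, (τ ++ [c]).length) := by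
      rintro k ⟨j, hj, hk⟩
      refine ⟨j, hj, ?_⟩
      induction hk with
      | refl => exact .refl
      | tail _ h ih =>
        exact ih.tail (.comm _ _ _ _ (by simp) le_rfl (by rw [List.take_length, obs_fn_append]) h)
    rintro (⟨rfl, hk⟩ | ⟨h0, i, hi, h⟩)
    · simpa using key k hk
    · obtain ⟨j, hj, hji⟩ := key i hi
      refine ⟨j, hj, (hji.tail (.past i _ (by simp; omega) le_rfl)).trans ?_⟩
      have : (τ ++ [c]).length - 1 = τ.length := by simp
      rw [this]
      exact ReflTransGen.mono (fun _ _ => ViewEdge.append) _ _ h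

variable (G) in
/-- Indistinguishability of histories for a set of players that share their views. -/
def Sim (J : Set (Fin (n + 1))) (τ τ' : List Γ) : Prop :=
  τ.length = τ'.length ∧ ∀ j ∈ J, G.Indist j τ τ'

theorem sim_singleton {j : Fin (n + 1)} {τ τ' : List Γ} : G.Sim {j} τ τ' ↔ G.Indist j τ τ' := by
  simp only [Sim, Set.mem_singleton_iff, forall_eq, and_iff_right_iff_imp]
  exact fun h => h.1

theorem sim_iff {J : Set (Fin (n + 1))} {τ τ' : List Γ} : G.Sim J τ τ' ↔ τ.length = τ'.length ∧
    ∀ k t, (∃ j ∈ J, ReflTransGen (G.ViewEdge τ) (j, τ.length) (k, t)) →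
      (G.obs k).fn (τ.take t) = (G.obs k).fn (τ'.take t) := by
  constructor
  · rintro ⟨h, h'⟩
    exact ⟨h, fun k t ⟨j, hj, hk⟩ => (h' j hj).2 k t hk⟩
  · rintro ⟨h, h'⟩
    exact ⟨h, fun j hj => ⟨h, fun k t hk => h' k t ⟨j, hj, hk⟩⟩⟩

theorem Sim.length_eq {J : Set (Fin (n + 1))} {τ τ' : List Γ} (h : G.Sim J τ τ') :
    τ.length = τ'.length := h.1

theorem Sim.mono {J J' : Set (Fin (n + 1))} {τ τ' : List Γ} (h : G.Sim J' τ τ') (hJ : J ⊆ J') :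
    G.Sim J τ τ' :=
  ⟨h.1, fun j hj => h.2 j (hJ hj)⟩

/-- The recursion on which everything rests: the view graph disappears, and only the closure of `J`
under the current links remains, which becomes the index one round earlier. -/
theorem sim_append {J : Set (Fin (n + 1))} {τ τ' : List Γ} {c c' : Γ} :
    G.Sim J (τ ++ [c]) (τ' ++ [c']) ↔
      (∀ k ∈ G.cl (G.ob (G.jrun τ) c) J, G.ob (G.jrun τ) c k = G.ob (G.jrun τ') c' k) ∧
      G.Sim (G.cl (G.ob (G.jrun τ) c) J) τ τ' := by
  rw [sim_iff, sim_iff]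
  simp only [reach_append_iff]
  constructor
  · rintro ⟨hl, h⟩
    have hl' : τ.length = τ'.length := by simpa using hl
    refine ⟨fun k hk => ?_, hl', fun k t hk => ?_⟩
    · have := h k _ (.inl ⟨rfl, hk⟩)
      rw [List.take_of_length_le (by simp), List.take_of_length_le (by simp [hl']),
        obs_fn_append, obs_fn_append] at this
      exact Option.some.inj this
    · obtain ⟨j, hj, hjk⟩ := hk
      have ht : t ≤ τ.length := reach_le hjk
      -- At length 0 the only node in question lies at time 0, where no observation is produced on
      -- either side.
      rcases Nat.eq_zero_or_pos τ.length with h0 | h0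
      · rw [h0] at ht
        obtain rfl : t = 0 := by omega
        rfl
      · have := h k t (.inr ⟨h0, j, hj, hjk⟩)
        rwa [List.take_append_of_le_length ht, List.take_append_of_le_length (hl' ▸ ht)] at this
  · rintro ⟨ho, hl, h⟩
    refine ⟨by simp [hl], ?_⟩
    rintro k t (⟨rfl, hk⟩ | ⟨h0, j, hj, hjk⟩)
    · rw [List.take_of_length_le (by simp), List.take_of_length_le (by simp [hl]),
        obs_fn_append, obs_fn_append, ho k hk]
    · have ht : t ≤ τ.length := reach_le hjk
      rw [List.take_append_of_le_length ht, List.take_append_of_le_length (hl ▸ ht)]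
      exact h k t ⟨j, hj, hjk⟩

theorem Sim.refl (J : Set (Fin (n + 1))) (τ : List Γ) : G.Sim J τ τ := by
  simp [sim_iff]

/-- The definition uses the view graph of the first history only. Symmetry comes from `cl_congr`:
agreement on the closure forces both histories to have the same closure. -/
theorem Sim.symm {J : Set (Fin (n + 1))} {τ τ' : List Γ} (h : G.Sim J τ τ') : G.Sim J τ' τ := by
  induction τ using List.reverseRecOn generalizing J τ' with
  | nil =>
    obtain rfl := List.eq_nil_of_length_eq_zero h.length_eq.symm
    exact h
  | append_singleton τ c ih =>
    rcases List.eq_nil_or_concat τ' with rfl | ⟨τ', c', rfl⟩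
    · have hl := h.length_eq
      simp at hl
    · rw [List.concat_eq_append] at h ⊢
      rw [sim_append] at h ⊢
      rw [cl_congr h.1]
      exact ⟨fun k hk => (h.1 k hk).symm, ih h.2⟩

theorem Sim.trans {J : Set (Fin (n + 1))} {τ₁ τ₂ τ₃ : List Γ} (h : G.Sim J τ₁ τ₂)
    (h' : G.Sim J τ₂ τ₃) : G.Sim J τ₁ τ₃ := by
  induction τ₁ using List.reverseRecOn generalizing J τ₂ τ₃ with
  | nil =>
    obtain rfl := List.eq_nil_of_length_eq_zero h.length_eq.symm
    exact h'
  | append_singleton τ₁ c₁ ih =>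
    have hl := h.length_eq
    have hl' := h'.length_eq
    rcases List.eq_nil_or_concat τ₂ with rfl | ⟨τ₂, c₂, rfl⟩
    · simp at hl
    rcases List.eq_nil_or_concat τ₃ with rfl | ⟨τ₃, c₃, rfl⟩
    · simp at hl'
    rw [List.concat_eq_append] at *
    rw [List.concat_eq_append] at *
    rw [sim_append] at h h' ⊢
    rw [cl_congr h.1] at h'
    exact ⟨fun k hk => (h.1 k hk).trans (h'.1 k hk), ih h.2 h'.2⟩

/-- A history that is indistinguishable from a nonempty one is nonempty. -/
theorem Sim.exists_append {J : Set (Fin (n + 1))} {τ ρ : List Γ} {c : Γ}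
    (h : G.Sim J (τ ++ [c]) ρ) : ∃ τ' c', ρ = τ' ++ [c'] := by
  have hl := h.length_eq
  rcases List.eq_nil_or_concat ρ with rfl | ⟨τ', c', rfl⟩
  · simp at hl
  · exact ⟨τ', c', List.concat_eq_append⟩

theorem Sim.of_append {J : Set (Fin (n + 1))} {τ τ' : List Γ} {c c' : Γ}
    (h : G.Sim J (τ ++ [c]) (τ' ++ [c'])) : G.Sim J τ τ' :=
  (sim_append.1 h).2.mono (subset_cl _ _)

end Game

/-! ### Finite types by recursion over a finite partial order. -/

section Types

open Set

/-- A numbering of the fibres of a function with finite range. -/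
noncomputable def label {W α : Type*} (g : W → α) (w : W) : ℕ :=
  open Classical in
  if h : (range g).Finite then
    have := h.to_subtype
    (Finite.equivFin (range g) ⟨g w, mem_range_self w⟩ : ℕ)
  else 0

theorem label_eq_iff {W α : Type*} {g : W → α} (h : (range g).Finite) {v w : W} :
    label g v = label g w ↔ g v = g w := by
  have := h.to_subtype
  simp only [label, h, dif_pos, Fin.val_inj, EmbeddingLike.apply_eq_iff_eq, Subtype.mk.injEq]

/-- The default value 0 makes this unconditional. Hence the types have finite range before anything
is known about the profiles, and the finiteness of the set of profiles can then be deduced from it.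
-/
theorem finite_range_label {W α : Type*} (g : W → α) : (range (label g)).Finite := by
  by_cases h : (range g).Finite
  · refine (finite_lt_nat (Nat.card (range g))).subset ?_
    rintro _ ⟨w, rfl⟩
    simp [label, h]
  · refine (finite_singleton 0).subset ?_
    rintro _ ⟨w, rfl⟩
    simp [label, h]

variable {ι W Q : Type*} [PartialOrder ι] [Finite ι]

/-- The set of the local types of the elements that are `R J`-related to a given one, for a given
assignment of types at the indices above `J`. -/
def profile (R : ι → W → W → Prop) (q : W → Q) (e : ι → W → ℕ) (J : ι) (w : W) : Set (Q × (ι → ℕ)) :=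
  open Classical in
  {z | ∃ v, R J w v ∧ z = (q v, fun J' => if J < J' then e J' v else 0)}

/-- A finite hierarchy of types: the type of an element at the index `J` determines, and is
determined by, the set of the types at higher indices of the elements that are `R J`-related to it. -/
theorem exists_types [Finite Q] (R : ι → W → W → Prop) (q : W → Q) :
    ∃ e : ι → W → ℕ, (∀ J, (range (e J)).Finite) ∧
      ∀ J w v, e J w = e J v ↔ profile R q e J w = profile R q e J v := by
  classical
  have wf : WellFounded ((· > ·) : ι → ι → Prop) := wellFounded_gt
  let e : ι → W → ℕ := wf.fix fun J ih =>
    label fun w => {z : Q × (ι → ℕ) |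
      ∃ v, R J w v ∧ z = (q v, fun J' => if h : J < J' then ih J' h v else 0)}
  have he : ∀ J, e J = label (profile R q e J) := by
    intro J
    refine (wf.fix_eq _ J).trans ?_
    congr 1
  have hfin : ∀ J, (range (e J)).Finite := fun J => he J ▸ finite_range_label _
  refine ⟨e, hfin, fun J w v => ?_⟩
  -- Every profile is a subset of one fixed finite product; the inserted 0 is the filler at indices
  -- that are not above `J`.
  have hp : (range (profile R q e J)).Finite := by
    have : (univ ×ˢ pi univ fun J' => insert 0 (range (e J')) : Set (Q × (ι → ℕ))).Finite :=
      finite_univ.prod (Finite.pi fun J' => (hfin J').insert 0)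
    refine this.finite_subsets.subset ?_
    rintro _ ⟨w, rfl⟩ _ ⟨v, -, rfl⟩
    refine ⟨mem_univ _, fun J' _ => ?_⟩
    simp only
    split_ifs
    · exact mem_insert_of_mem _ (mem_range_self v)
    · exact mem_insert _ _
  rw [he J, label_eq_iff hp]

end Types

/-! ### The finite abstraction of the players' knowledge. -/

namespace Game

variable {n : ℕ} {A Γ S : Type}

/-- The data of a finite abstraction of the knowledge of the players in a game: a deterministic
automaton that keeps track of the joint state and of a type for every set of players. -/
@[ext]
structure Abstraction (G : Game n A Γ S) (X : Type) where
  /-- the initial state -/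
  init : X
  /-- the transition function -/
  step : X → Γ → X
  /-- the joint state of the automata of the game -/
  key : X → G.Joint
  /-- the type at a set of players -/
  type : Set (Fin (n + 1)) → X → ℕ

namespace Abstraction

variable {G : Game n A Γ S} {X : Type} (D : Abstraction G X)

/-- The state reached on a history. -/
def run (τ : List Γ) : X := τ.foldl D.step D.init

theorem run_append (τ : List Γ) (c : Γ) : D.run (τ ++ [c]) = D.step (D.run τ) c := by
  simp [run]

/-- The players whose views are received by the players of `J` on a move at a state. -/
def next (J : Set (Fin (n + 1))) (x : X) (c : Γ) : Set (Fin (n + 1)) := G.cl (G.ob (D.key x) c) J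

/-- Two moves yield the same observations of the players of `K`. -/
def Agree (K : Set (Fin (n + 1))) (x : X) (c : Γ) (y : X) (d : Γ) : Prop :=
  ∀ k ∈ K, G.ob (D.key x) c k = G.ob (D.key y) d k

/-- Equality of the joint states and of the types at all supersets of `J`. -/
def Equiv (J : Set (Fin (n + 1))) (x y : X) : Prop :=
  D.key x = D.key y ∧ ∀ J', J ⊆ J' → D.type J' x = D.type J' y

/-- The local conditions under which types determine what sets of players consider possible. -/
structure Valid : Prop where
  key_init : D.key D.init = G.jrun []
  key_step : ∀ x c, D.key (D.step x c) = G.jstep (D.key x) c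
  forth : ∀ J x c y d, D.Agree (D.next J x c) x c y d →
    D.type (D.next J x c) x = D.type (D.next J x c) y → D.type J (D.step x c) = D.type J (D.step y d)
  back : ∀ J x c y, D.type J (D.step x c) = D.type J y → ∃ z d, D.Agree (D.next J x c) x c z d ∧
    D.type (D.next J x c) x = D.type (D.next J x c) z ∧ D.Equiv J (D.step z d) y
  base : ∀ J y, D.type J D.init = D.type J y → D.Equiv J D.init y
  congr : ∀ J x y c, D.Equiv (D.next J x c) x y → D.Equiv J (D.step x c) (D.step y c)
  reachable : ∀ x, ∃ τ, D.run τ = x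

end Abstraction

/-- The states are the pairs of a joint state and a family of types that occur for some history. The
transitions are well defined because these data determine the types after the next move, which is
`e_congr` below. -/
theorem exists_abstraction [Finite Γ] (G : Game n A Γ S) :
    ∃ (N : ℕ) (D : Abstraction G (Fin (N + 1))), D.Valid := by
  classical
  have : ∀ i, Finite (G.obs i).State := fun i => (G.obs i).finite
  have : Finite G.color.State := G.color.finite
  obtain ⟨e, hfin, he⟩ := exists_types G.Sim G.jrun
  have e_sim : ∀ {J τ τ'}, G.Sim J τ τ' → e J τ = e J τ' := by
    intro J τ τ' h
    rw [he]
    ext z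
    exact ⟨fun ⟨v, hv, hz⟩ => ⟨v, h.symm.trans hv, hz⟩, fun ⟨v, hv, hz⟩ => ⟨v, h.trans hv, hz⟩⟩
  -- The entry of `τ'` in its own profile also occurs in the profile of `τ`, and `ρ` is the history
  -- that contributes it there.
  have e_back : ∀ {J τ τ'}, e J τ = e J τ' → ∃ ρ, G.Sim J τ ρ ∧ G.jrun ρ = G.jrun τ' ∧
      ∀ J', J ⊆ J' → e J' ρ = e J' τ' := by
    intro J τ τ' h
    have h1 := (he J τ τ').1 h
    have h2 : (G.jrun τ', fun J' => if J < J' then e J' τ' else 0) ∈ profile G.Sim G.jrun e J τ := by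
      rw [h1]
      exact ⟨τ', .refl _ _, rfl⟩
    obtain ⟨ρ, hρ, hz⟩ := h2
    obtain ⟨hz1, hz2⟩ := Prod.ext_iff.1 hz
    refine ⟨ρ, hρ, hz1.symm, fun J' hJ' => ?_⟩
    rcases hJ'.eq_or_lt with rfl | hlt
    · rw [← e_sim hρ, h]
    · have := congrFun hz2 J'
      simp only [hlt, if_true] at this
      exact this.symm
  -- Induction from large sets to small ones. A history `ρ ++ [d]` in the class of `τ ++ [c]` is
  -- matched by `ρ' ++ [d]`, where `ρ'` copies the state of `ρ` and its types above the closure `K`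
  -- within the class of `τ'`. The types at larger `J'` then agree by induction, since the closure
  -- of `J'` contains `K`.
  have e_congr : ∀ J τ τ' c, G.jrun τ = G.jrun τ' →
      (∀ J', G.cl (G.ob (G.jrun τ) c) J ⊆ J' → e J' τ = e J' τ') →
      e J (τ ++ [c]) = e J (τ' ++ [c]) := by
    intro J
    induction J using (wellFounded_gt (α := Set (Fin (n + 1)))).induction with
    | _ J ih =>
    have key : ∀ τ τ' c, G.jrun τ = G.jrun τ' →
        (∀ J', G.cl (G.ob (G.jrun τ) c) J ⊆ J' → e J' τ = e J' τ') →
        profile G.Sim G.jrun e J (τ ++ [c]) ⊆ profile G.Sim G.jrun e J (τ' ++ [c]) := by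
      rintro τ τ' c hq hτ _ ⟨v, hv, rfl⟩
      obtain ⟨ρ, d, rfl⟩ := hv.exists_append
      obtain ⟨ho, hs⟩ := sim_append.1 hv
      set K := G.cl (G.ob (G.jrun τ) c) J with hK
      obtain ⟨ρ', hρ', hq', hty⟩ := e_back (((hτ K subset_rfl).symm.trans (e_sim hs)))
      refine ⟨ρ' ++ [d], sim_append.2 ⟨?_, ?_⟩, ?_⟩
      · rw [← hq, hq']
        exact ho
      · rwa [← hq]
      · rw [jrun_append, jrun_append, hq']
        refine Prod.ext rfl (funext fun J' => ?_)
        simp only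
        split_ifs with hJ'
        · refine (ih J' hJ' ρ' ρ d hq' fun J'' hJ'' => hty J'' ((?_ : K ⊆ _).trans hJ'')).symm
          rw [hq', hK, ← cl_congr ho]
          exact cl_mono _ hJ'.le
        · rfl
    intro τ τ' c hq hτ
    rw [he]
    exact (key τ τ' c hq hτ).antisymm (key τ' τ c hq.symm fun J' hJ' => (hτ J' (hq ▸ hJ')).symm)
  -- The joint states of `τ` and `τ'` may differ here: one passes to `ρ`, indistinguishable from `τ`
  -- but with the state of `τ'`, before applying `e_congr`.
  have e_forth : ∀ J τ c τ' d,
      (∀ k ∈ G.cl (G.ob (G.jrun τ) c) J, G.ob (G.jrun τ) c k = G.ob (G.jrun τ') d k) →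
      e (G.cl (G.ob (G.jrun τ) c) J) τ = e (G.cl (G.ob (G.jrun τ) c) J) τ' →
      e J (τ ++ [c]) = e J (τ' ++ [d]) := by
    intro J τ c τ' d ho hτ
    obtain ⟨ρ, hρ, hq, hty⟩ := e_back hτ
    rw [← e_congr J ρ τ' d hq fun J' hJ' => hty J' (by rwa [hq, cl_congr ho] at hJ')]
    exact e_sim (sim_append.2 ⟨by rwa [hq], hρ⟩)
  let g : List Γ → G.Joint × (Set (Fin (n + 1)) → ℕ) := fun τ => (G.jrun τ, fun J => e J τ)
  have hg : (Set.range g).Finite := by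
    have : (Set.univ ×ˢ Set.pi Set.univ fun J => Set.range (e J) :
        Set (G.Joint × (Set (Fin (n + 1)) → ℕ))).Finite :=
      Set.finite_univ.prod (Set.Finite.pi hfin)
    refine this.subset ?_
    rintro _ ⟨τ, rfl⟩
    exact ⟨Set.mem_univ _, fun J _ => Set.mem_range_self τ⟩
  have := hg.to_subtype
  obtain ⟨N, ⟨f⟩⟩ := Finite.exists_equiv_fin (Set.range g)
  obtain ⟨N, rfl⟩ : ∃ N', N = N' + 1 :=
    Nat.exists_eq_succ_of_ne_zero fun h => by subst h; exact (f ⟨g [], [], rfl⟩).elim0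
  let φ : List Γ → Fin (N + 1) := fun τ => f ⟨g τ, τ, rfl⟩
  have hφ : Function.Surjective φ := by
    intro x
    obtain ⟨τ, hτ⟩ := (f.symm x).2
    refine ⟨τ, ?_⟩
    rw [← f.apply_symm_apply x]
    exact congrArg f (Subtype.ext hτ)
  obtain ⟨rep, hrep⟩ := hφ.hasRightInverse
  have hφq : ∀ {τ τ'}, φ τ = φ τ' → G.jrun τ = G.jrun τ' := fun h =>
    congrArg Prod.fst (congrArg Subtype.val (f.injective h))
  have hφe : ∀ {τ τ'}, φ τ = φ τ' → ∀ J, e J τ = e J τ' := fun h J =>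
    congrFun (congrArg Prod.snd (congrArg Subtype.val (f.injective h))) J
  have hφs : ∀ {τ τ'}, φ τ = φ τ' → ∀ c, φ (τ ++ [c]) = φ (τ' ++ [c]) := by
    intro τ τ' h c
    refine congrArg f (Subtype.ext (Prod.ext ?_ (funext fun J => ?_)))
    · change G.jrun _ = G.jrun _
      rw [jrun_append, jrun_append, hφq h]
    · exact e_congr J τ τ' c (hφq h) fun J' _ => hφe h J'
  let D : Abstraction G (Fin (N + 1)) :=
    ⟨φ [], fun x c => φ (rep x ++ [c]), fun x => G.jrun (rep x), fun J x => e J (rep x)⟩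
  have key_φ : ∀ τ, D.key (φ τ) = G.jrun τ := fun τ => hφq (hrep (φ τ))
  have type_φ : ∀ J τ, D.type J (φ τ) = e J τ := fun J τ => hφe (hrep (φ τ)) J
  have step_φ : ∀ τ c, D.step (φ τ) c = φ (τ ++ [c]) := fun τ c => hφs (hrep (φ τ)) c
  have run_φ : ∀ τ, D.run τ = φ τ := by
    intro τ
    induction τ using List.reverseRecOn with
    | nil => rfl
    | append_singleton τ c ih => rw [Abstraction.run_append, ih, step_φ]
  refine ⟨N, D, ?_, ?_, ?_, ?_, ?_, ?_, ?_⟩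
  · exact key_φ []
  · intro x c
    obtain ⟨τ, rfl⟩ := hφ x
    rw [step_φ, key_φ, key_φ, jrun_append]
  · intro J x c y d
    obtain ⟨τ, rfl⟩ := hφ x
    obtain ⟨τ', rfl⟩ := hφ y
    simp only [Abstraction.Agree, Abstraction.next, step_φ, key_φ, type_φ]
    exact e_forth J τ c τ' d
  · intro J x c y
    obtain ⟨τ, rfl⟩ := hφ x
    obtain ⟨τ', rfl⟩ := hφ y
    simp only [Abstraction.Agree, Abstraction.next, Abstraction.Equiv, step_φ, key_φ, type_φ]
    intro h
    obtain ⟨ρ, hρ, hq, hty⟩ := e_back h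
    obtain ⟨ρ, d, rfl⟩ := hρ.exists_append
    obtain ⟨ho, hs⟩ := sim_append.1 hρ
    refine ⟨φ ρ, d, ?_, ?_, ?_, ?_⟩ <;> simp only [step_φ, key_φ, type_φ]
    exacts [ho, e_sim hs, hq, hty]
  · intro J y
    obtain ⟨τ', rfl⟩ := hφ y
    change D.type J (φ []) = _ → D.Equiv J (φ []) _
    simp only [Abstraction.Equiv, key_φ, type_φ]
    intro h
    obtain ⟨ρ, hρ, hq, hty⟩ := e_back h
    obtain rfl := List.eq_nil_of_length_eq_zero hρ.length_eq.symm
    exact ⟨hq, hty⟩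
  · intro J x y c
    obtain ⟨τ, rfl⟩ := hφ x
    obtain ⟨τ', rfl⟩ := hφ y
    simp only [Abstraction.next, Abstraction.Equiv, step_φ, key_φ, type_φ]
    rintro ⟨hq, hty⟩
    refine ⟨by rw [jrun_append, jrun_append, hq], fun J' hJ' => ?_⟩
    exact e_congr J' τ τ' c hq fun J'' hJ'' => hty J'' ((cl_mono _ hJ').trans hJ'')
  · intro x
    obtain ⟨τ, rfl⟩ := hφ x
    exact ⟨τ, run_φ τ⟩

end Game

/-! ### Positional determinacy of finite parity games, with ranks. -/

section Parity

variable {V : Type*}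

/-- The ranks `r p`, for the priorities `p` that are congruent to `b` modulo `2`, do not increase from
`v` to `w` if the priority of `v` is at least `p`, and decrease if it is equal to `p`. -/
def Descends (b : ℕ) (c : ℕ) (r : ℕ → V → ℕ) (v w : V) : Prop :=
  ∀ p, p % 2 = b → p ≤ c → r p w ≤ r p v ∧ (p = c → r p w < r p v)

theorem Descends.of_lt {b c : ℕ} {r : ℕ → V → ℕ} {v w : V}
    (h : ∀ p, p % 2 = b → p ≤ c → r p w < r p v) : Descends b c r v w :=
  fun p hp hpc => ⟨(h p hp hpc).le, fun _ => h p hp hpc⟩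

/-- The parity of the priorities that are bad for a player; `true` is the player who wants the least
recurring priority to be even. -/
def bad (i : Bool) : ℕ := cond i 1 0

/-- The player `i` wins on the set `W` in the subgame with vertex set `U`, by a positional strategy
witnessed by ranks. -/
def Wins (own : V → Bool) (E : V → V → Prop) (pr : V → ℕ) (i : Bool) (U W : Set V) : Prop :=
  W ⊆ U ∧ ∃ r : ℕ → V → ℕ, ∀ v ∈ W,
    (own v = i → ∃ w ∈ W, E v w ∧ Descends (bad i) (pr v) r v w) ∧
    (own v ≠ i → ∀ w ∈ U, E v w → w ∈ W ∧ Descends (bad i) (pr v) r v w)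

variable {own : V → Bool} {E : V → V → Prop} {pr : V → ℕ}

theorem Wins.empty (i : Bool) (U : Set V) : Wins own E pr i U ∅ :=
  ⟨Set.empty_subset _, fun _ _ => 0, fun _ h => h.elim⟩

theorem exists_bound {U : Set V} (hU : U.Finite) (d : V → ℕ) : ∃ M, ∀ v ∈ U, d v < M := by
  obtain ⟨M, hM⟩ := (hU.image d).bddAbove
  exact ⟨M + 1, fun v hv => Nat.lt_succ_of_le (hM ⟨v, hv, rfl⟩)⟩

/-- The attractor of a set of vertices. -/
theorem exists_attractor (own : V → Bool) (E : V → V → Prop) (i : Bool) {U T : Set V} (hU : U.Finite)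
    (hT : T ⊆ U) : ∃ (B : Set V) (d : V → ℕ), T ⊆ B ∧ B ⊆ U ∧
      (∀ v ∈ B, v ∉ T → (own v = i → ∃ w ∈ B, E v w ∧ d w < d v) ∧
        (own v ≠ i → ∀ w ∈ U, E v w → w ∈ B ∧ d w < d v)) ∧
      (∀ v ∈ U, v ∉ B → (own v = i → ∀ w ∈ B, ¬ E v w) ∧
        (own v ≠ i → ∃ w ∈ U \ B, E v w)) := by
  let L : ℕ → Set V := Nat.rec T fun _ L => L ∪ {v | v ∈ U ∧ (own v = i → ∃ w ∈ L, E v w) ∧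
    (own v ≠ i → ∀ w ∈ U, E v w → w ∈ L)}
  have hL : Monotone L := monotone_nat_of_le_succ fun k => Set.subset_union_left
  have hLU : ∀ k, L k ⊆ U := by
    intro k
    induction k with
    | zero => exact hT
    | succ k ih => exact Set.union_subset ih fun v hv => hv.1
  let d : V → ℕ := fun v => sInf {k | v ∈ L k}
  have hd : ∀ {v k}, v ∈ L k → d v ≤ k := fun h => Nat.sInf_le h
  have hd' : ∀ {v k}, v ∈ L k → v ∈ L (d v) := fun {v k} h =>
    Nat.sInf_mem (s := {k | v ∈ L k}) ⟨k, h⟩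
  refine ⟨⋃ k, L k, d, Set.subset_iUnion L 0, Set.iUnion_subset hLU, ?_, ?_⟩
  · intro v hv hvT
    obtain ⟨k, hk⟩ := Set.mem_iUnion.1 hv
    have hv' := hd' hk
    rcases hm : d v with _ | m
    · rw [hm] at hv'
      exact (hvT hv').elim
    rw [hm] at hv'
    have hvm : v ∉ L m := fun h => by
      have := hd h
      omega
    obtain ⟨-, h1, h2⟩ := hv'.resolve_left hvm
    refine ⟨fun ho => ?_, fun ho w hw hvw => ?_⟩
    · obtain ⟨w, hw, hvw⟩ := h1 ho
      exact ⟨w, Set.mem_iUnion.2 ⟨m, hw⟩, hvw, Nat.lt_succ_of_le (hd hw)⟩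
    · exact ⟨Set.mem_iUnion.2 ⟨m, h2 ho w hw hvw⟩, Nat.lt_succ_of_le (hd (h2 ho w hw hvw))⟩
  · intro v hv hvB
    have hvB' : ∀ k, v ∉ L k := fun k hk => hvB (Set.mem_iUnion.2 ⟨k, hk⟩)
    refine ⟨fun ho w hw hvw => ?_, fun ho => ?_⟩
    · obtain ⟨k, hk⟩ := Set.mem_iUnion.1 hw
      exact hvB' (k + 1) (.inr ⟨hv, fun _ => ⟨w, hk, hvw⟩, fun h => (h ho).elim⟩)
    · by_contra! hcon
      -- By finiteness, if all successors lie in the attractor then they lie in one common level, so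
      -- the vertex would enter the next level.
      obtain ⟨M, hM⟩ := exists_bound hU d
      refine hvB' (M + 1) (.inr ⟨hv, fun h => (ho h).elim, fun _ w hw hvw => ?_⟩)
      by_cases hwB : w ∈ ⋃ k, L k
      · obtain ⟨k, hk⟩ := Set.mem_iUnion.1 hwB
        exact hL (hM w hw).le (hd' hk)
      · exact (hcon w ⟨hw, hwB⟩ hvw).elim

theorem total_sdiff {i : Bool} {U B : Set V} (htot : ∀ v ∈ U, ∃ w ∈ U, E v w)
    (hB : ∀ v ∈ U, v ∉ B → (own v = i → ∀ w ∈ B, ¬ E v w) ∧ (own v ≠ i → ∃ w ∈ U \ B, E v w)) :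
    ∀ v ∈ U \ B, ∃ w ∈ U \ B, E v w := by
  rintro v ⟨hv, hvB⟩
  by_cases ho : own v = i
  · obtain ⟨w, hw, hvw⟩ := htot v hv
    exact ⟨w, ⟨hw, fun h => (hB v hv hvB).1 ho w h hvw⟩, hvw⟩
  · exact (hB v hv hvB).2 ho

/-- If the player who likes the least priority wins everywhere outside the attractor of the vertices
of least priority, then this player wins everywhere. -/
theorem wins_of_attractor {i : Bool} {U B : Set V} {p : ℕ} {d : V → ℕ} (hU : U.Finite)
    (htot : ∀ v ∈ U, ∃ w ∈ U, E v w) (hp : p % 2 ≠ bad i) (hmin : ∀ v ∈ U, p ≤ pr v) (hBU : B ⊆ U)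
    (hB : ∀ v ∈ B, pr v ≠ p → (own v = i → ∃ w ∈ B, E v w ∧ d w < d v) ∧
        (own v ≠ i → ∀ w ∈ U, E v w → w ∈ B ∧ d w < d v))
    (hW : Wins own E pr i (U \ B) (U \ B)) : Wins own E pr i U U := by
  classical
  obtain ⟨-, r, hr⟩ := hW
  obtain ⟨M, hM⟩ := exists_bound hU d
  -- The offset `M` puts all ranks outside `B` above those inside, so entering `B` is a descent.
  -- Ranks for priorities below `p` are never required to drop, and `p` itself is not bad for player
  -- `i`.
  let r' : ℕ → V → ℕ := fun q v => if q < p then 0 else if v ∈ B then d v else r q v + M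
  have hlow : ∀ v ∈ U, ∀ w, pr v = p → Descends (bad i) (pr v) r' v w := by
    intro v hv w hvp q hq hqp
    have : q < p := lt_of_le_of_ne (hvp ▸ hqp) fun h => hp (h ▸ hq)
    simp only [r', this, if_true, le_refl, true_and]
    omega
  have hstep : ∀ v ∈ U, ∀ w, (∀ q, ¬ q < p → r' q w < r' q v) → Descends (bad i) (pr v) r' v w := by
    intro v hv w h q hq hqp
    by_cases hqp' : q < p
    · have := hmin v hv
      simp only [r', hqp', if_true, le_refl, true_and]
      omega
    · exact ⟨(h q hqp').le, fun _ => h q hqp'⟩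
  have hout : ∀ v ∈ U \ B, ∀ w ∈ U \ B, Descends (bad i) (pr v) r v w →
      Descends (bad i) (pr v) r' v w := by
    intro v hv w hw h q hq hqp
    by_cases hqp' : q < p
    · have := hmin v hv.1
      simp only [r', hqp', if_true, le_refl, true_and]
      omega
    · have := h q hq hqp
      simp only [r', hqp', if_false, hv.2, hw.2]
      omega
  refine ⟨subset_rfl, r', fun v hv => ?_⟩
  by_cases hvp : pr v = p
  · obtain ⟨w, hw, hvw⟩ := htot v hv
    exact ⟨fun _ => ⟨w, hw, hvw, hlow v hv w hvp⟩, fun _ w hw _ => ⟨hw, hlow v hv w hvp⟩⟩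
  by_cases hvB : v ∈ B
  · have hBB : ∀ w ∈ B, d w < d v → Descends (bad i) (pr v) r' v w := by
      intro w hw hd
      refine hstep v hv w fun q hq => ?_
      simpa only [r', hq, if_false, hvB, hw, if_true] using hd
    refine ⟨fun ho => ?_, fun ho w hw hvw => ⟨hw, ?_⟩⟩
    · obtain ⟨w, hw, hvw, hd⟩ := (hB v hvB hvp).1 ho
      exact ⟨w, hBU hw, hvw, hBB w hw hd⟩
    · obtain ⟨hwB, hd⟩ := (hB v hvB hvp).2 ho w hw hvw
      exact hBB w hwB hd
  · refine ⟨fun ho => ?_, fun ho w hw hvw => ⟨hw, ?_⟩⟩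
    · obtain ⟨w, hw, hvw, hd⟩ := (hr v ⟨hv, hvB⟩).1 ho
      exact ⟨w, hw.1, hvw, hout v ⟨hv, hvB⟩ w hw hd⟩
    · by_cases hwB : w ∈ B
      · refine hstep v hv w fun q hq => ?_
        have := hM w hw
        simp only [r', hq, if_false, hvB, hwB, if_true]
        omega
      · exact hout v ⟨hv, hvB⟩ w ⟨hw, hwB⟩ (((hr v ⟨hv, hvB⟩).2 ho w ⟨hw, hwB⟩ hvw).2)

/-- A winning set can be enlarged by its attractor and by the winning set of the remaining game. -/
theorem Wins.union {i : Bool} {U B W W' : Set V} {d : V → ℕ} (hU : U.Finite)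
    (hWB : W ⊆ B) (hBU : B ⊆ U)
    (hB : ∀ v ∈ B, v ∉ W → (own v = i → ∃ w ∈ B, E v w ∧ d w < d v) ∧
        (own v ≠ i → ∀ w ∈ U, E v w → w ∈ B ∧ d w < d v))
    (hW : Wins own E pr i U W) (hW' : Wins own E pr i (U \ B) W') :
    Wins own E pr i U (B ∪ W') := by
  classical
  obtain ⟨-, r, hr⟩ := hW
  obtain ⟨hW'U, r', hr'⟩ := hW'
  choose M hM using fun q => exists_bound hU (r q)
  let s : ℕ → V → ℕ := fun q v => if v ∈ W then r q v else d v + M q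
  choose M' hM' using fun q => exists_bound hU (s q)
  -- Three layers of ranks, lowest first: `W`, its attractor, and the winning set of the remaining
  -- game. The opponent can leave a layer only downwards.
  let t : ℕ → V → ℕ := fun q v => if v ∈ B then s q v else r' q v + M' q
  refine ⟨Set.union_subset hBU (hW'U.trans Set.sdiff_subset), t, fun v hv => ?_⟩
  by_cases hvW : v ∈ W
  · have hvB := hWB hvW
    have key : ∀ w ∈ W, Descends (bad i) (pr v) r v w → Descends (bad i) (pr v) t v w := by
      intro w hw h q
      simpa only [t, s, hvB, hWB hw, hvW, hw, if_true] using h q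
    refine ⟨fun ho => ?_, fun ho w hw hvw => ?_⟩
    · obtain ⟨w, hw, hvw, h⟩ := (hr v hvW).1 ho
      exact ⟨w, .inl (hWB hw), hvw, key w hw h⟩
    · obtain ⟨hwW, h⟩ := (hr v hvW).2 ho w hw hvw
      exact ⟨.inl (hWB hwW), key w hwW h⟩
  by_cases hvB : v ∈ B
  · have key : ∀ w ∈ B, d w < d v → Descends (bad i) (pr v) t v w := by
      intro w hw h
      refine .of_lt fun q _ _ => ?_
      simp only [t, s, hvB, hw, hvW, if_true, if_false]
      split_ifs
      · have := hM q w (hBU hw)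
        omega
      · omega
    refine ⟨fun ho => ?_, fun ho w hw hvw => ?_⟩
    · obtain ⟨w, hw, hvw, h⟩ := (hB v hvB hvW).1 ho
      exact ⟨w, .inl hw, hvw, key w hw h⟩
    · obtain ⟨hwB, h⟩ := (hB v hvB hvW).2 ho w hw hvw
      exact ⟨.inl hwB, key w hwB h⟩
  · have hvW' := hv.resolve_left hvB
    have key : ∀ w ∈ W', Descends (bad i) (pr v) r' v w → Descends (bad i) (pr v) t v w := by
      intro w hw h q hq hqv
      have := h q hq hqv
      simp only [t, hvB, (hW'U hw).2, if_false]
      omega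
    refine ⟨fun ho => ?_, fun ho w hw hvw => ?_⟩
    · obtain ⟨w, hw, hvw, h⟩ := (hr' v hvW').1 ho
      exact ⟨w, .inr hw, hvw, key w hw h⟩
    · by_cases hwB : w ∈ B
      · refine ⟨.inl hwB, .of_lt fun q _ _ => ?_⟩
        have := hM' q w hw
        simp only [t, hvB, hwB, if_true, if_false]
        omega
      · obtain ⟨hwW, h⟩ := (hr' v hvW').2 ho w ⟨hw, hwB⟩ hvw
        exact ⟨.inr hwW, key w hwW h⟩

/-- A winning set of a subgame that the opponent cannot leave is a winning set. -/
theorem Wins.of_sdiff {i : Bool} {U B W : Set V} (hW : Wins own E pr i (U \ B) W)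
    (hB : ∀ v ∈ U, v ∉ B → own v ≠ i → ∀ w ∈ B, ¬ E v w) : Wins own E pr i U W := by
  obtain ⟨hWU, r, hr⟩ := hW
  refine ⟨hWU.trans Set.sdiff_subset, r, fun v hv => ⟨(hr v hv).1, fun ho w hw hvw => ?_⟩⟩
  exact (hr v hv).2 ho w ⟨hw, fun h => hB v (hWU hv).1 (hWU hv).2 ho w h hvw⟩ hvw

/-- Finite parity games are positionally determined. -/
theorem parity_determined (own : V → Bool) (E : V → V → Prop) (pr : V → ℕ) {U : Set V}
    (hU : U.Finite) (htot : ∀ v ∈ U, ∃ w ∈ U, E v w) :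
    ∃ W : Bool → Set V, (∀ i, Wins own E pr i U (W i)) ∧ ∀ v ∈ U, ∃ i, v ∈ W i := by
  induction hk : U.ncard using Nat.strong_induction_on generalizing U with
  | _ k ih =>
  rcases U.eq_empty_or_nonempty with rfl | hne
  · exact ⟨fun _ => ∅, fun i => .empty i _, fun v hv => hv.elim⟩
  have hsub : ∀ {B : Set V}, (B ∩ U).Nonempty → (∀ v ∈ U \ B, ∃ w ∈ U \ B, E v w) →
      ∃ W : Bool → Set V, (∀ i, Wins own E pr i (U \ B) (W i)) ∧ ∀ v ∈ U \ B, ∃ i, v ∈ W i := by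
    intro B hB htot'
    refine ih _ ?_ (hU.subset Set.sdiff_subset) htot' rfl
    rw [← hk]
    refine Set.ncard_lt_ncard ?_ hU
    obtain ⟨v, hvB, hvU⟩ := hB
    exact ⟨Set.sdiff_subset, fun h => (h hvU).2 hvB⟩
  obtain ⟨v₀, hv₀, hmin⟩ := hU.exists_minimalFor pr _ hne
  replace hmin : ∀ v ∈ U, pr v₀ ≤ pr v := fun v hv => by
    rcases le_total (pr v₀) (pr v) with h | h
    · exact h
    · exact hmin hv h
  obtain ⟨i, hi⟩ : ∃ i, pr v₀ % 2 ≠ bad i := by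
    rcases Nat.mod_two_eq_zero_or_one (pr v₀) with h | h
    · exact ⟨true, by simp [h, bad]⟩
    · exact ⟨false, by simp [h, bad]⟩
  obtain ⟨B, d, hTB, hBU, hB, hB'⟩ :=
    exists_attractor own E i hU (T := {v ∈ U | pr v = pr v₀}) fun v hv => hv.1
  obtain ⟨W, hW, hWU⟩ := hsub ⟨v₀, hTB ⟨hv₀, rfl⟩, hv₀⟩ (total_sdiff htot hB')
  have hcases : ∀ j, j = i ∨ j = !i := by
    intro j
    cases i <;> cases j <;> simp
  have hnot : ∀ v, own v = (!i) ↔ own v ≠ i := fun v => Bool.eq_not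
  -- Zielonka's recursion: either the opponent wins nothing outside the attractor of the least
  -- priority, or its winning set there is already winning in `U`, and removing the opponent's
  -- attractor of that set leaves a smaller game.
  rcases (W (!i)).eq_empty_or_nonempty with he | hne'
  · refine ⟨fun j => {v ∈ U | j = i}, fun j => ?_, fun v hv => ⟨i, hv, rfl⟩⟩
    rcases hcases j with rfl | rfl
    · have hWj : W j = U \ B := (hW j).1.antisymm fun v hv => by
        obtain ⟨k, hk⟩ := hWU v hv
        rcases hcases k with rfl | rfl
        · exact hk
        · rw [he] at hk
          exact hk.elim
      simp only [and_true, Set.ofPred_mem_eq]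
      refine wins_of_attractor hU htot hi hmin hBU (fun v hv hvp => hB v hv fun h => hvp h.2) ?_
      have := hW j
      rwa [hWj] at this
    · simpa using Wins.empty (!i) U
  · have hWi : Wins own E pr (!i) U (W (!i)) :=
      (hW (!i)).of_sdiff fun v hv hvB ho => (hB' v hv hvB).1 (by simpa [hnot] using ho)
    obtain ⟨C, d', hWC, hCU, hC, hC'⟩ := exists_attractor own E (!i) hU hWi.1
    obtain ⟨W', hW', hWU'⟩ := hsub (hne'.mono fun v hv => ⟨hWC hv, hWi.1 hv⟩) (total_sdiff htot hC')
    have hw1 : Wins own E pr (!i) U (C ∪ W' (!i)) := hWi.union hU hWC hCU hC (hW' (!i))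
    have hw2 : Wins own E pr i U (W' i) :=
      (hW' i).of_sdiff fun v hv hvC ho => (hC' v hv hvC).1 ((hnot v).2 ho)
    refine ⟨fun j => if j = i then W' i else C ∪ W' (!i), fun j => ?_, fun v hv => ?_⟩
    · rcases hcases j with rfl | rfl
      · simpa using hw2
      · simpa using hw1
    · by_cases hvC : v ∈ C
      · exact ⟨!i, by simp [hvC]⟩
      · obtain ⟨j, hj⟩ := hWU' v ⟨hv, hvC⟩
        rcases hcases j with rfl | rfl
        · exact ⟨j, by simpa using hj⟩
        · exact ⟨!i, by simp [hj]⟩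

end Parity

/-! ### Local forms of visibility and of winning on abstract positions. -/

namespace Game

variable {n : ℕ} {A Γ S : Type} {G : Game n A Γ S} {X : Type}

theorem playPrefix_succ (π : ℕ → Γ) (t : ℕ) : playPrefix π (t + 1) = playPrefix π t ++ [π t] := by
  simp [playPrefix, List.range_succ]

theorem color_trace (π : ℕ → Γ) (t : ℕ) :
    G.color.trace π t = G.pri (G.jrun (playPrefix π t)) (π t) := rfl

namespace Abstraction

variable (D : Abstraction G X)

/-- The abstract position of the active player at a state. -/
def pos (x : X) : ℕ := D.type {0} x

/-- Positional winning strategies of the active player on abstract positions. -/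
def SysWins (W : ℕ → Prop) (σ : ℕ → A) (r : ℕ → ℕ → ℕ) : Prop :=
  W (D.pos D.init) ∧ ∀ x c, W (D.pos x) → G.act c = σ (D.pos x) →
    W (D.pos (D.step x c)) ∧ Descends 1 (G.pri (D.key x) c) r (D.pos x) (D.pos (D.step x c))

/-- Positional winning strategies of Nature on abstract positions. -/
def EnvWins (W : ℕ → Prop) (y : ℕ → A → X) (d : ℕ → A → Γ) (r : ℕ → ℕ → ℕ) : Prop :=
  W (D.pos D.init) ∧ ∀ x a, W (D.pos x) →
    D.pos (y (D.pos x) a) = D.pos x ∧ G.act (d (D.pos x) a) = a ∧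
    W (D.pos (D.step (y (D.pos x) a) (d (D.pos x) a))) ∧
    Descends 0 (G.pri (D.key (y (D.pos x) a)) (d (D.pos x) a)) r (D.pos x)
      (D.pos (D.step (y (D.pos x) a) (d (D.pos x) a)))

/-- The local form of visibility of actions. -/
def ActVis : Prop :=
  ∀ x c y d, G.ob (D.key x) c 0 = G.ob (D.key y) d 0 → G.act c = G.act d

/-- The local form of visibility of priorities. -/
def ColVis : Prop :=
  ∀ x c y d, D.Agree (D.next {0} x c) x c y d →
    D.type (D.next {0} x c) x = D.type (D.next {0} x c) y → G.pri (D.key x) c = G.pri (D.key y) d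

variable {D}

theorem Equiv.mono {J K : Set (Fin (n + 1))} {x y : X} (h : D.Equiv J x y) (hJ : J ⊆ K) :
    D.Equiv K x y :=
  ⟨h.1, fun J' hJ' => h.2 J' (hJ.trans hJ')⟩

namespace Valid

theorem key_run (τ : List Γ) (hD : D.Valid) : D.key (D.run τ) = G.jrun τ := by
  induction τ using List.reverseRecOn with
  | nil => exact hD.key_init
  | append_singleton τ c ih => rw [run_append, hD.key_step, ih, jrun_append]

theorem next_run (hD : D.Valid) (J : Set (Fin (n + 1))) (τ : List Γ) (c : Γ) :
    D.next J (D.run τ) c = G.cl (G.ob (G.jrun τ) c) J := by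
  rw [next, key_run τ hD]

/-- The forth condition is the inductive step of this statement along `sim_append`. -/
theorem type_eq_of_sim (hD : D.Valid) {J : Set (Fin (n + 1))} {τ τ' : List Γ} (h : G.Sim J τ τ') :
    D.type J (D.run τ) = D.type J (D.run τ') := by
  induction τ using List.reverseRecOn generalizing J τ' with
  | nil =>
    obtain rfl := List.eq_nil_of_length_eq_zero h.length_eq.symm
    rfl
  | append_singleton τ c ih =>
    obtain ⟨τ', d, rfl⟩ := h.exists_append
    obtain ⟨ho, hs⟩ := sim_append.1 h
    rw [run_append, run_append]
    refine hD.forth J _ c _ d ?_ ?_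
    · intro k hk
      rw [hD.next_run] at hk
      rw [key_run τ hD, key_run τ' hD]
      exact ho k hk
    · rw [hD.next_run]
      exact ih hs

/-- The back condition supplies a predecessor `z` of a state equivalent to `y`; the induction
hypothesis at the larger set realises `z` by a history up to equivalence, and the congruence
condition carries this over the last move. -/
theorem exists_sim (hD : D.Valid) {J : Set (Fin (n + 1))} {τ : List Γ} {y : X}
    (h : D.type J (D.run τ) = D.type J y) : ∃ τ', G.Sim J τ τ' ∧ D.Equiv J (D.run τ') y := by
  induction τ using List.reverseRecOn generalizing J y with
  | nil => exact ⟨[], .refl _ _, hD.base J y h⟩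
  | append_singleton τ c ih =>
    rw [run_append] at h
    obtain ⟨z, d, ho, hz, hy⟩ := hD.back J _ c y h
    obtain ⟨τ', hτ', hE⟩ := ih hz
    rw [hD.next_run] at hτ'
    have hob : ∀ k ∈ G.cl (G.ob (G.jrun τ) c) J,
        G.ob (G.jrun τ) c k = G.ob (D.key (D.run τ')) d k := by
      intro k hk
      rw [hE.1, ← key_run τ hD]
      exact ho k (by rwa [hD.next_run])
    refine ⟨τ' ++ [d], sim_append.2 ⟨?_, hτ'⟩, ?_⟩
    · rwa [← key_run τ' hD]
    · have hnext : D.next J (D.run τ') d = D.next J (D.run τ) c := by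
        rw [hD.next_run, hD.next_run, ← key_run τ' hD]
        exact cl_congr hob
      have := hD.congr J (D.run τ') z d (by rwa [hnext])
      rw [run_append]
      exact ⟨this.1.trans hy.1, fun J' hJ' => (this.2 J' hJ').trans (hy.2 J' hJ')⟩

theorem actionVisible_iff (hD : D.Valid) : G.ActionVisible ↔ D.ActVis := by
  constructor
  · intro h x c y d ho
    obtain ⟨τ, rfl⟩ := hD.reachable x
    obtain ⟨τ', rfl⟩ := hD.reachable y
    by_contra hne
    refine h c d hne τ τ' ?_
    rw [obs_fn_append, obs_fn_append, ← key_run τ hD, ← key_run τ' hD, ho]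
  · intro h c d hne τ τ' ho
    rw [obs_fn_append, obs_fn_append, ← key_run τ hD, ← key_run τ' hD] at ho
    exact hne (h _ _ _ _ (Option.some.inj ho))

/-- Reachability turns the first abstract state into a history, and `exists_sim` turns the second
into an indistinguishable one, so a local violation is a genuine violation. -/
theorem colorVisible_iff (hD : D.Valid) : G.ColorVisible ↔ D.ColVis := by
  constructor
  · intro h x c y d ho hty
    obtain ⟨τ, rfl⟩ := hD.reachable x
    obtain ⟨τ', hs, hE⟩ := hD.exists_sim hty
    have hs' : G.Sim {0} (τ ++ [c]) (τ' ++ [d]) := by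
      refine sim_append.2 ⟨fun k hk => ?_, by rwa [hD.next_run] at hs⟩
      rw [← key_run τ hD, ← key_run τ' hD, hE.1]
      exact ho k (by rwa [hD.next_run])
    have := h _ _ (sim_singleton.1 hs')
    rw [color_fn_append, color_fn_append, ← key_run τ hD, ← key_run τ' hD, hE.1] at this
    exact Option.some.inj this
  · intro h τ τ' hs
    replace hs := sim_singleton.2 hs
    rcases List.eq_nil_or_concat τ with rfl | ⟨τ, c, rfl⟩
    · obtain rfl := List.eq_nil_of_length_eq_zero hs.length_eq.symm
      rfl
    · rw [List.concat_eq_append] at hs ⊢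
      obtain ⟨τ', d, rfl⟩ := hs.exists_append
      obtain ⟨ho, hs⟩ := sim_append.1 hs
      rw [color_fn_append, color_fn_append, ← key_run τ hD, ← key_run τ' hD]
      refine congrArg some (h _ _ _ _ ?_ ?_)
      · intro k hk
        rw [hD.next_run] at hk
        rw [key_run τ hD, key_run τ' hD]
        exact ho k hk
      · rw [hD.next_run]
        exact hD.type_eq_of_sim hs

end Valid

end Abstraction

end Game

/-! ### Infinite sequences: ranks against recurring priorities, and Kőnig's lemma. -/

theorem exists_least_frequent {u : ℕ → ℕ} (hu : BddAbove (Set.range u)) :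
    ∃ p, (∀ᶠ t in Filter.atTop, p ≤ u t) ∧ ∃ᶠ t in Filter.atTop, u t = p := by
  have hne : ∃ p, ∃ᶠ t in Filter.atTop, u t = p := by
    obtain ⟨B, hB⟩ := hu
    by_contra! hcon
    obtain ⟨t, ht⟩ := ((Filter.eventually_all_finset (Finset.range (B + 1))).2
      fun p _ => hcon p).exists
    exact ht (u t) (Finset.mem_range.2 (Nat.lt_succ_of_le (hB ⟨t, rfl⟩))) rfl
  classical
  refine ⟨Nat.find hne, ?_, Nat.find_spec hne⟩
  filter_upwards [(Filter.eventually_all_finset (Finset.range (Nat.find hne))).2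
    fun p hp => Filter.not_frequently.1 (Nat.find_min hne (Finset.mem_range.1 hp))] with t ht
  by_contra hlt
  exact ht (u t) (Finset.mem_range.2 (not_le.1 hlt)) rfl

/-- Once all priorities are at least `p`, the rank for `p` never increases again, yet it drops at
every later occurrence of `p`. -/
theorem Descends.contradiction {b : ℕ} {u k : ℕ → ℕ} {r : ℕ → ℕ → ℕ}
    (h : ∀ t, Descends b (u t) r (k t) (k (t + 1))) {p : ℕ} (hp : p % 2 = b)
    (h1 : ∀ᶠ t in Filter.atTop, p ≤ u t) (h2 : ∃ᶠ t in Filter.atTop, u t = p) : False := by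
  obtain ⟨T, hT⟩ := Filter.eventually_atTop.1 h1
  have hanti : ∀ t s, T ≤ t → t ≤ s → r p (k s) ≤ r p (k t) := by
    intro t s ht hts
    induction s, hts using Nat.le_induction with
    | base => exact le_rfl
    | succ s hs ih => exact (h s p hp (hT s (ht.trans hs))).1.trans ih
  have hbound : ∀ m, ∃ t, T ≤ t ∧ r p (k t) + m ≤ r p (k T) := by
    intro m
    induction m with
    | zero => exact ⟨T, le_rfl, le_rfl⟩
    | succ m ih =>
      obtain ⟨t, ht, hm⟩ := ih
      obtain ⟨s, hs, hsp⟩ := Filter.frequently_atTop.1 h2 t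
      refine ⟨s + 1, by omega, ?_⟩
      have h3 := (h s p hp (hT s (ht.trans hs))).2 hsp.symm
      have h4 := hanti t s ht hs
      omega
  obtain ⟨t, -, ht⟩ := hbound (r p (k T) + 1)
  omega

/-- Kőnig's lemma for words over a finite alphabet. -/
theorem exists_play {Γ : Type} [Finite Γ] (P : List Γ → Prop) (h : ∀ τ c, P (τ ++ [c]) → P τ)
    (hne : ∀ t, ∃ τ, τ.length = t ∧ P τ) : ∃ π : ℕ → Γ, ∀ t, P (playPrefix π t) := by
  have htake : ∀ k τ, P τ → P (τ.take k) := by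
    intro k τ
    induction τ using List.reverseRecOn with
    | nil => simp
    | append_singleton τ c ih =>
      intro hτ
      rcases Nat.lt_or_ge τ.length k with hk | hk
      · rwa [List.take_of_length_le (by simp; omega)]
      · rw [List.take_append_of_le_length hk]
        exact ih (h τ c hτ)
  let α : ℕ → Type := fun t => {τ : List Γ // τ.length = t ∧ P τ}
  have : Finite (α 0) := by
    refine Set.Finite.to_subtype ((List.finite_length_eq Γ 0).subset fun τ hτ => hτ.1)
  have : ∀ t, Nonempty (α t) := fun t => let ⟨τ, hτ⟩ := hne t; ⟨⟨τ, hτ⟩⟩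
  obtain ⟨f, hf⟩ := exists_seq_forall_proj_of_forall_finite (α := α)
    (fun {i j} hij τ => ⟨τ.1.take i, by simp [τ.2.1, hij], htake i _ τ.2.2⟩)
    (fun i a => Subtype.ext (List.take_of_length_le a.2.1.le))
    (fun i j k hij hjk a => Subtype.ext (by simp [List.take_take, hij]))
    (fun i a => by
      have : Finite (α (i + 1)) := Set.Finite.to_subtype
        ((List.finite_length_eq Γ (i + 1)).subset fun τ hτ => hτ.1)
      exact Set.toFinite _)
  let π : ℕ → Γ := fun t => (f (t + 1)).1[t]'(by have := (f (t + 1)).2.1; omega)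
  refine ⟨π, fun t => ?_⟩
  have : playPrefix π t = (f t).1 := by
    refine List.ext_getElem (by simp [playPrefix, (f t).2.1]) fun k h1 h2 => ?_
    have hk : k < t := by simpa [playPrefix] using h1
    have := congrArg Subtype.val (hf (Nat.succ_le_of_lt hk))
    simp only at this
    have h3 : (playPrefix π t)[k] = π k := by simp [playPrefix]
    rw [h3]
    simp only [π, ← this, List.getElem_take]
  rw [this]
  exact (f t).2.2

/-! ### Transfer between the abstract parity game and the original game. -/

namespace Game.Abstraction

variable {n : ℕ} {A Γ S : Type} {G : Game n A Γ S} {X : Type} {D : Abstraction G X}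

theorem SysWins.hasWinningStrategy [Finite X] [Finite Γ] (hD : D.Valid) {W : ℕ → Prop} {σ : ℕ → A}
    {r : ℕ → ℕ → ℕ} (h : D.SysWins W σ r) : G.HasWinningStrategy := by
  refine ⟨fun τ => σ (D.pos (D.run τ)), fun τ τ' hs => ?_, fun π hπ => ?_⟩
  · exact congrArg σ (hD.type_eq_of_sim (sim_singleton.2 hs))
  · let x : ℕ → X := fun t => D.run (playPrefix π t)
    have hx : ∀ t, x (t + 1) = D.step (x t) (π t) := fun t => by
      simp only [x, playPrefix_succ, run_append]
    have hW : ∀ t, W (D.pos (x t)) := by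
      intro t
      induction t with
      | zero => exact h.1
      | succ t ih => rw [hx]; exact (h.2 _ _ ih (hπ t)).1
    have hcol : ∀ t, G.color.trace π t = G.pri (D.key (x t)) (π t) := fun t => by
      rw [color_trace, hD.key_run]
    have hdesc : ∀ t, Descends 1 (G.color.trace π t) r (D.pos (x t)) (D.pos (x (t + 1))) := by
      intro t
      rw [hx, hcol]
      exact (h.2 _ _ (hW t) (hπ t)).2
    have hbdd : BddAbove (Set.range (G.color.trace π)) := by
      refine ((Set.finite_range fun z : X × Γ => G.pri (D.key z.1) z.2).subset ?_).bddAbove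
      rintro _ ⟨t, rfl⟩
      exact ⟨(x t, π t), (hcol t).symm⟩
    obtain ⟨p, h1, h2⟩ := exists_least_frequent hbdd
    refine ⟨p, ?_, h1, h2⟩
    by_contra hp
    exact Descends.contradiction hdesc (Nat.odd_iff.1 (Nat.not_even_iff_odd.1 hp)) h1 h2

/-- Nature may answer from any history that Player `0` cannot tell from the current one. The
resulting histories are not prefixes of one play, and visibility makes up for that. -/
theorem EnvWins.not_hasWinningStrategy [Finite Γ] (hD : D.Valid) (hA : G.ActionVisible)
    (hC : G.ColorVisible) {W : ℕ → Prop} {y : ℕ → A → X} {d : ℕ → A → Γ} {r : ℕ → ℕ → ℕ}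
    (h : D.EnvWins W y d r) : ¬ G.HasWinningStrategy := by
  rintro ⟨s, hs, hwin⟩
  have hstep : ∀ τ, W (D.pos (D.run τ)) → ∃ τ' c, G.Sim {0} τ τ' ∧ G.act c = s τ ∧
      W (D.pos (D.run (τ' ++ [c]))) ∧ Descends 0 (G.pri (G.jrun τ') c) r (D.pos (D.run τ))
        (D.pos (D.run (τ' ++ [c]))) := by
    intro τ hτ
    obtain ⟨h1, h2, h3, h4⟩ := h.2 _ (s τ) hτ
    set z := y (D.pos (D.run τ)) (s τ)
    set c := d (D.pos (D.run τ)) (s τ)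
    obtain ⟨τ', hτ', hE⟩ := hD.exists_sim h1.symm
    have hE' := hD.congr {0} _ z c (hE.mono (subset_cl _ _))
    have hpos : D.pos (D.run (τ' ++ [c])) = D.pos (D.step z c) := by
      rw [run_append]
      exact hE'.2 _ subset_rfl
    refine ⟨τ', c, hτ', h2, by rwa [hpos], ?_⟩
    rwa [hpos, ← hD.key_run, hE.1]
  have : Nonempty Γ := ⟨d (D.pos D.init) (s [])⟩
  choose! f c hsim hact hW hdesc using hstep
  -- In each round the current history is replaced by an indistinguishable one that realises the
  -- state chosen by Nature, and then extended by the chosen move.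
  let ρ : ℕ → List Γ := Nat.rec [] fun _ τ => f τ ++ [c τ]
  have hρ : ∀ t, ρ (t + 1) = f (ρ t) ++ [c (ρ t)] := fun _ => rfl
  have hρW : ∀ t, W (D.pos (D.run (ρ t))) := by
    intro t
    induction t with
    | zero => exact h.1
    | succ t ih => exact hW _ ih
  have hlen : ∀ t, (ρ t).length = t := by
    intro t
    induction t with
    | zero => rfl
    | succ t ih =>
      rw [hρ, List.length_append, ← (hsim _ (hρW t)).length_eq, ih]
      rfl
  -- The histories indistinguishable from the `ρ t` form a prefix-closed tree with nonempty levels,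
  -- because indistinguishability persists when last moves are dropped.
  obtain ⟨π, hπ⟩ := exists_play (fun τ => G.Sim {0} (ρ τ.length) τ)
    (by
      intro τ e hτ
      rw [List.length_append] at hτ
      exact (hsim _ (hρW _)).trans (Sim.of_append hτ))
    (fun t => ⟨ρ t, hlen t, by simpa only [hlen t] using Sim.refl {0} (ρ t)⟩)
  have hπ' : ∀ t, G.Sim {0} (ρ t) (playPrefix π t) := by
    intro t
    simpa [playPrefix] using hπ t
  have hπs : ∀ t, G.Sim {0} (f (ρ t) ++ [c (ρ t)]) (playPrefix π t ++ [π t]) := by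
    intro t
    rw [← hρ, ← playPrefix_succ]
    exact hπ' (t + 1)
  have hfol : G.Follows π s := by
    intro t
    rw [← hs _ _ (sim_singleton.1 (hπ' t)), ← hact _ (hρW t)]
    -- Player `0` makes the same last observation on both histories, so the moves have the same
    -- action by visibility.
    by_contra hne
    refine hA _ _ hne (playPrefix π t) (f (ρ t)) ?_
    rw [obs_fn_append, obs_fn_append]
    exact congrArg some ((sim_append.1 (hπs t)).1 0 (subset_cl _ _ rfl)).symm
  have hcol : ∀ t, G.color.trace π t = G.pri (G.jrun (f (ρ t))) (c (ρ t)) := by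
    intro t
    have := hC _ _ (sim_singleton.1 (hπs t))
    rw [color_fn_append, color_fn_append] at this
    exact (Option.some.inj this).symm
  obtain ⟨p, hp, h1, h2⟩ := hwin π hfol
  refine Descends.contradiction (u := G.color.trace π) (k := fun t => D.pos (D.run (ρ t))) (r := r)
    (fun t => ?_) (Nat.even_iff.1 hp) h1 h2
  rw [hcol]
  exact hdesc _ (hρW t)

/-- The vertices of the parity game on abstract positions. -/
inductive Vertex (A Γ X : Type)
  /-- the active player chooses an action -/
  | pos (k : ℕ)
  /-- Nature chooses a move that is supported by the action -/
  | choice (k : ℕ) (a : A)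
  /-- the effect of a move -/
  | move (x : X) (c : Γ)

/-- The edges of the parity game on abstract positions. -/
inductive Edge (D : Abstraction G X) : Vertex A Γ X → Vertex A Γ X → Prop
  | choose (k : ℕ) (a : A) : Edge D (.pos k) (.choice k a)
  | stuck (k : ℕ) (a : A) : (∀ x c, D.pos x = k → G.act c ≠ a) → Edge D (.choice k a) (.choice k a)
  | move (k : ℕ) (a : A) (x : X) (c : Γ) : D.pos x = k → G.act c = a →
      Edge D (.choice k a) (.move x c)
  | land (x : X) (c : Γ) (k : ℕ) : k = D.pos (D.step x c) → Edge D (.move x c) (.pos k)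

theorem exists_positional_strategy [Finite X] [Finite Γ] [Finite A] [Nonempty A]
    (D : Abstraction G X) :
    (∃ W σ r, D.SysWins W σ r) ∨ ∃ W y d r, D.EnvWins W y d r := by
  classical
  obtain ⟨M, hM⟩ := (Set.finite_range fun z : X × Γ => G.pri (D.key z.1) z.2).bddAbove
  replace hM : ∀ x c, G.pri (D.key x) c ≤ M := fun x c => hM ⟨(x, c), rfl⟩
  let own : Vertex A Γ X → Bool := fun
    | .choice _ _ => false
    | _ => true
  -- Auxiliary vertices get the largest priority `M`, so that the real priorities decide. An action
  -- without supporting moves gives a self-loop of priority 0: Player `0` wins there, as no play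
  -- follows such a choice.
  let pr : Vertex A Γ X → ℕ := fun
    | .pos _ => M
    | .choice k a => if ∀ x c, D.pos x = k → G.act c ≠ a then 0 else M
    | .move x c => G.pri (D.key x) c
  let f : X ⊕ X × A ⊕ X × Γ → Vertex A Γ X := fun
    | .inl x => .pos (D.pos x)
    | .inr (.inl (x, a)) => .choice (D.pos x) a
    | .inr (.inr (x, c)) => .move x c
  have hf1 : ∀ x, Vertex.pos (D.pos x) ∈ Set.range f := fun x => ⟨.inl x, rfl⟩
  have hf2 : ∀ x a, Vertex.choice (D.pos x) a ∈ Set.range f := fun x a => ⟨.inr (.inl (x, a)), rfl⟩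
  have hf3 : ∀ x c, Vertex.move x c ∈ Set.range f := fun x c => ⟨.inr (.inr (x, c)), rfl⟩
  obtain ⟨W, hW, hWU⟩ := parity_determined own (Edge D) pr (Set.finite_range f) <| by
    rintro _ ⟨x | ⟨x, a⟩ | ⟨x, c⟩, rfl⟩
    · exact ⟨_, hf2 x (Classical.arbitrary A), .choose _ _⟩
    · by_cases hs : ∀ z c, D.pos z = D.pos x → G.act c ≠ a
      · exact ⟨_, hf2 x a, .stuck _ _ hs⟩
      · push Not at hs
        obtain ⟨z, c, hz, hc⟩ := hs
        exact ⟨_, hf3 z c, .move _ _ z c hz hc⟩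
    · exact ⟨_, hf1 (D.step x c), .land _ _ _ rfl⟩
  have hpr : ∀ x c, pr (.choice (D.pos x) (G.act c)) = M := fun x c =>
    if_neg fun h => h x c rfl rfl
  -- One round is three edges. The two auxiliary ones never raise a relevant rank, so the descent of
  -- the last edge is that of the whole round.
  have hcomp : ∀ (b : ℕ) (r : ℕ → Vertex A Γ X → ℕ) (k k' : ℕ) (a : A) (x : X) (c : Γ),
      Descends b M r (.pos k) (.choice k a) → Descends b M r (.choice k a) (.move x c) →
      Descends b (G.pri (D.key x) c) r (.move x c) (.pos k') →
      Descends b (G.pri (D.key x) c) (fun p k => r p (.pos k)) k k' := by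
    intro b r k k' a x c h1 h2 h3 p hp hpc
    have h4 := h1 p hp (hpc.trans (hM x c))
    have h5 := h2 p hp (hpc.trans (hM x c))
    have h6 := h3 p hp hpc
    simp only
    omega
  obtain ⟨i, hi⟩ := hWU _ (hf1 D.init)
  cases i with
  | true =>
    left
    obtain ⟨-, r, hr⟩ := hW true
    have hσ : ∀ k, Vertex.pos k ∈ W true → ∃ a, Vertex.choice k a ∈ W true ∧
        Descends 1 M r (.pos k) (.choice k a) := by
      intro k hk
      obtain ⟨w, hw, he, hd⟩ := (hr _ hk).1 rfl
      cases he
      exact ⟨_, hw, hd⟩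
    choose! σ hσW hσd using hσ
    refine ⟨fun k => Vertex.pos k ∈ W true, σ, fun p k => r p (.pos k), hi, fun x c hx hc => ?_⟩
    obtain ⟨hmW, hmd⟩ := (hr _ (hσW _ hx)).2 (by simp [own]) (.move x c) (hf3 x c)
      (.move _ _ _ _ rfl hc)
    obtain ⟨w, hw, he, hd⟩ := (hr _ hmW).1 rfl
    cases he with
    | land _ _ k hk =>
      subst hk
      refine ⟨hw, hcomp 1 r _ _ _ x c (hσd _ hx) ?_ hd⟩
      rw [← hc] at hmd ⊢
      rw [hpr] at hmd
      exact hmd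
  | false =>
    right
    obtain ⟨-, r, hr⟩ := hW false
    have hy : ∀ k a, Vertex.choice k a ∈ W false → ∃ x c, D.pos x = k ∧ G.act c = a ∧
        Vertex.move x c ∈ W false ∧ Descends 0 M r (.choice k a) (.move x c) := by
      intro k a hk
      obtain ⟨w, hw, he, hd⟩ := (hr _ hk).1 rfl
      cases he with
      | stuck _ _ hs =>
        -- Nature cannot win at a stuck vertex: its rank for priority 0 would have to drop along the
        -- self-loop.
        have h0 : pr (.choice k a) = 0 := if_pos hs
        have := (hd 0 rfl (Nat.zero_le _)).2 h0.symm
        omega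
      | move _ _ x c hx hc =>
        subst hx hc
        rw [hpr] at hd
        exact ⟨x, c, rfl, rfl, hw, hd⟩
    have : Nonempty X := ⟨D.init⟩
    obtain hΓ | hΓ := isEmpty_or_nonempty Γ
    · obtain ⟨-, c, -⟩ := hy _ _ ((hr _ hi).2 (by simp [own]) _
        (hf2 D.init (Classical.arbitrary A)) (.choose _ _)).1
      exact hΓ.elim c
    choose! y c hyk hya hyW hyd using hy
    refine ⟨fun k => Vertex.pos k ∈ W false, y, c, fun p k => r p (.pos k), hi, fun x a hx => ?_⟩
    obtain ⟨hcW, hcd⟩ := (hr _ hx).2 (by simp [own]) _ (hf2 x a) (.choose _ _)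
    obtain ⟨hlW, hld⟩ := (hr _ (hyW _ _ hcW)).2 (by simp [own]) _ (hf1 _) (.land _ _ _ rfl)
    exact ⟨hyk _ _ hcW, hya _ _ hcW, hlW, hcomp 0 r _ _ a _ _ hcd (hyd _ _ hcW) hld⟩

end Game.Abstraction

/-! ### Bounded quantifiers and sets of players coded by binary numbers. -/

/-- Bounded universal quantification. -/
def ball (n : ℕ) (f : ℕ → Bool) : Bool := (List.range n).all f

/-- Bounded existential quantification. -/
def bex (n : ℕ) (f : ℕ → Bool) : Bool := (List.range n).any f

/-- Universal quantification over the sets of players `0, …, n`, coded by numbers. -/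
def ballSet (n : ℕ) (f : ℕ → Bool) : Bool := ball (2 ^ (n + 1)) f

/-- Implication of Booleans. -/
def imp (a b : Bool) : Bool := !a || b

theorem imp_iff {a b : Bool} : imp a b = true ↔ (a = true → b = true) := by
  cases a <;> cases b <;> simp [imp]

theorem ball_iff {n : ℕ} {f : ℕ → Bool} : ball n f = true ↔ ∀ x < n, f x = true := by
  simp [ball]

theorem ball_fin_iff {n : ℕ} {f : ℕ → Bool} : ball n f = true ↔ ∀ x : Fin n, f x = true := by
  simp [ball, Fin.forall_iff]

theorem bex_fin_iff {n : ℕ} {f : ℕ → Bool} : bex n f = true ↔ ∃ x : Fin n, f x = true := by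
  simp [bex, Fin.exists_iff]

/-- The number of a set of players. -/
noncomputable def setCode {n : ℕ} (J : Set (Fin (n + 1))) : ℕ :=
  open Classical in
  Nat.ofBits fun i => decide (i ∈ J)

/-- Membership in the set of players with a given number. -/
def memCode (m i : ℕ) : Bool := m / 2 ^ i % 2 == 1

theorem memCode_eq_testBit (m i : ℕ) : memCode m i = m.testBit i := by
  rw [Nat.testBit_eq_decide_div_mod_eq, memCode, beq_eq_decide]

theorem memCode_setCode {n : ℕ} {J : Set (Fin (n + 1))} {i : Fin (n + 1)} :
    memCode (setCode J) i = true ↔ i ∈ J := by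
  rw [memCode_eq_testBit, setCode, Nat.testBit_ofBits_lt _ _ i.2]
  simp

theorem setCode_lt {n : ℕ} (J : Set (Fin (n + 1))) : setCode J < 2 ^ (n + 1) :=
  Nat.ofBits_lt_two_pow _

theorem setCode_surj {n m : ℕ} (hm : m < 2 ^ (n + 1)) : ∃ J : Set (Fin (n + 1)), setCode J = m := by
  refine ⟨{i | m.testBit i}, ?_⟩
  have := Nat.ofBits_testBit m (n + 1)
  rw [Nat.mod_eq_of_lt hm] at this
  conv_rhs => rw [← this]
  simp [setCode]

/-- This is why the literal 1 stands for `{0}` in the checks below. -/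
theorem setCode_zero {n : ℕ} : setCode ({0} : Set (Fin (n + 1))) = 1 := by
  obtain ⟨J, hJ⟩ := setCode_surj (n := n) (m := 1) (Nat.one_lt_two_pow (by omega))
  refine Eq.trans (congrArg setCode ?_) hJ
  ext i
  rw [← memCode_setCode (J := J), hJ, memCode]
  rcases Nat.eq_zero_or_pos (i : ℕ) with h | h
  · simp [h, Fin.ext_iff]
  · simp [Nat.div_eq_of_lt (Nat.one_lt_two_pow h.ne'), Fin.ext_iff, h.ne']

theorem ballSet_iff {n : ℕ} {f : ℕ → Bool} :
    ballSet n f = true ↔ ∀ J : Set (Fin (n + 1)), f (setCode J) = true := by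
  rw [ballSet, ball_iff]
  constructor
  · exact fun h J => h _ (setCode_lt J)
  · intro h m hm
    obtain ⟨J, rfl⟩ := setCode_surj hm
    exact h J

/-- Certificates: the largest state of an abstraction, a list of histories that lead to its states,
and a list of tables. -/
abbrev Cert : Type := ℕ × List (List ℕ) × List (List (List ℕ))

/-- The entry in row `i` and column `j` of the table number `k` of a certificate. -/
def Cert.tab (w : Cert) (k i j : ℕ) : ℕ := ((w.2.2.getD k []).getD i []).getD j 0

/-! ### Certificates: tables 0–4 hold the abstraction, 5 the winning positions, 6 the ranks, 7
Player `0`'s actions, 8 and 9 Nature's states and moves. -/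

namespace GameCode

variable (c : GameCode) (w : Cert)

/-- The code of the observation automaton of a player. -/
def mealy (i : ℕ) : MealyCode := c.obs.getD i ⟨0, 0, []⟩

/-- The abstraction described by a certificate. -/
noncomputable def abs : c.game.Abstraction (Fin (w.1 + 1)) where
  init := Fin.ofNat (w.1 + 1) (w.tab 0 0 0)
  step x g := Fin.ofNat (w.1 + 1) (w.tab 1 x g)
  key x := (fun i => Fin.ofNat ((c.mealy i).maxState + 1) (w.tab 2 i x),
    Fin.ofNat (c.color.maxState + 1) (w.tab 3 0 x))
  type J x := w.tab 4 (setCode J) x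

/-- The initial state of the abstraction. -/
def cInit (w : Cert) : ℕ := w.tab 0 0 0 % (w.1 + 1)

/-- The transition function of the abstraction. -/
def cStep (w : Cert) (x g : ℕ) : ℕ := w.tab 1 x g % (w.1 + 1)

/-- The state of the observation automaton of Player `i` at a state of the abstraction. -/
def cState (i x : ℕ) : ℕ := w.tab 2 i x % ((c.mealy i).maxState + 1)

/-- The state of the colouring automaton at a state of the abstraction. -/
def cColor (x : ℕ) : ℕ := w.tab 3 0 x % (c.color.maxState + 1)

/-- The type of a state at a set of players. -/
def cType (w : Cert) (J x : ℕ) : ℕ := w.tab 4 J x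

/-- The observation of Player `i`. -/
def cOb (x g i : ℕ) : ℕ := ((c.mealy i).entry (c.cState w i x) g).2 % (c.maxObs + 1)

/-- The priority of a move. -/
def cPri (x g : ℕ) : ℕ := (c.color.entry (c.cColor w x) g).2

/-- The action that supports a move. -/
def cAct (g : ℕ) : ℕ := c.act.getD g 0 % (c.maxAction + 1)

/-- Inclusion of sets of players. -/
def cSub (n J K : ℕ) : Bool := ball (n + 1) fun i => imp (memCode J i) (memCode K i)

/-- Closure of a set of players under the links that are active on a move. -/
def cClosed (x g K : ℕ) : Bool :=
  ball (c.observers + 1) fun i => ball (c.observers + 1) fun k =>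
    imp (memCode K i && c.links.contains (c.cOb w x g i, i, k)) (memCode K k)

/-- The set `K` is the set of players that are reached from `J` along the links. -/
def cNext (J x g K : ℕ) : Bool :=
  cSub c.observers J K && c.cClosed w x g K && ballSet c.observers fun K' =>
    imp (cSub c.observers J K' && c.cClosed w x g K') (cSub c.observers K K')

/-- Agreement of observations. -/
def cAgree (K x g y d : ℕ) : Bool :=
  ball (c.observers + 1) fun i => imp (memCode K i) (c.cOb w x g i == c.cOb w y d i)

/-- Equality of the joint states and of the types at all supersets of `J`. -/
def cEquiv (J x y : ℕ) : Bool :=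
  ball (c.observers + 1) (fun i => c.cState w i x == c.cState w i y) &&
  c.cColor w x == c.cColor w y &&
  ballSet c.observers fun J' => imp (cSub c.observers J J') (cType w J' x == cType w J' y)

/-- The abstraction keeps track of the joint state. -/
def cKeys : Bool :=
  ball (c.observers + 1) (fun i =>
    c.cState w i (cInit w) == (c.mealy i).init % ((c.mealy i).maxState + 1)) &&
  c.cColor w (cInit w) == c.color.init % (c.color.maxState + 1) &&
  ball (w.1 + 1) fun x => ball (c.maxMove + 1) fun g =>
    ball (c.observers + 1) (fun i => c.cState w i (cStep w x g) ==
      ((c.mealy i).entry (c.cState w i x) g).1 % ((c.mealy i).maxState + 1)) &&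
    c.cColor w (cStep w x g) == (c.color.entry (c.cColor w x) g).1 % (c.color.maxState + 1)

/-- The forth condition. -/
def cForth : Bool :=
  ballSet c.observers fun J => ballSet c.observers fun K =>
  ball (w.1 + 1) fun x => ball (c.maxMove + 1) fun g =>
  imp (c.cNext w J x g K) <| ball (w.1 + 1) fun y => ball (c.maxMove + 1) fun d =>
    imp (c.cAgree w K x g y d) <| imp (cType w K x == cType w K y)
      (cType w J (cStep w x g) == cType w J (cStep w y d))

/-- The back condition. -/
def cBack : Bool :=
  ballSet c.observers fun J => ballSet c.observers fun K =>
  ball (w.1 + 1) fun x => ball (c.maxMove + 1) fun g =>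
  imp (c.cNext w J x g K) <| ball (w.1 + 1) fun y =>
    imp (cType w J (cStep w x g) == cType w J y) <|
    bex (w.1 + 1) fun z => bex (c.maxMove + 1) fun d =>
      c.cAgree w K x g z d && (cType w K x == cType w K z && c.cEquiv w J (cStep w z d) y)

/-- The condition on the initial state. -/
def cBase : Bool :=
  ballSet c.observers fun J => ball (w.1 + 1) fun y =>
    imp (cType w J (cInit w) == cType w J y) (c.cEquiv w J (cInit w) y)

/-- The congruence condition. -/
def cCongr : Bool :=
  ballSet c.observers fun J => ballSet c.observers fun K =>
  ball (w.1 + 1) fun x => ball (c.maxMove + 1) fun g =>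
  imp (c.cNext w J x g K) <| ball (w.1 + 1) fun y =>
    imp (c.cEquiv w K x y) (c.cEquiv w J (cStep w x g) (cStep w y g))

/-- All states are reachable by the histories given in the certificate. -/
def cReach : Bool :=
  ball (w.1 + 1) fun x =>
    (w.2.1.getD x []).foldl (fun y g => cStep w y (g % (c.maxMove + 1))) (cInit w) == x

/-- The certificate describes a valid abstraction. -/
def cValid : Bool :=
  c.cKeys w && (c.cForth w && (c.cBack w && (c.cBase w && (c.cCongr w && c.cReach w))))

/-- Visibility of actions. -/
def cActVis : Bool :=
  ball (w.1 + 1) fun x => ball (c.maxMove + 1) fun g => ball (w.1 + 1) fun y =>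
  ball (c.maxMove + 1) fun d => imp (c.cOb w x g 0 == c.cOb w y d 0) (c.cAct g == c.cAct d)

/-- Visibility of priorities. -/
def cColVis : Bool :=
  ballSet c.observers fun K => ball (w.1 + 1) fun x => ball (c.maxMove + 1) fun g =>
  imp (c.cNext w 1 x g K) <| ball (w.1 + 1) fun y => ball (c.maxMove + 1) fun d =>
    imp (c.cAgree w K x g y d) <| imp (cType w K x == cType w K y) (c.cPri w x g == c.cPri w y d)

/-- The winning positions in a certificate. -/
def cWin (w : Cert) (k : ℕ) : Bool := w.tab 5 0 k == 1

/-- The rank conditions in a certificate. -/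
def cDesc (w : Cert) (b m k k' : ℕ) : Bool :=
  ball (m + 1) fun p => imp (p % 2 == b)
    (decide (w.tab 6 p k' ≤ w.tab 6 p k) && imp (p == m) (decide (w.tab 6 p k' < w.tab 6 p k)))

/-- The certificate describes a winning strategy of the active player. -/
def cSysWins : Bool :=
  cWin w (cType w 1 (cInit w)) &&
  ball (w.1 + 1) fun x => ball (c.maxMove + 1) fun g =>
    imp (cWin w (cType w 1 x)) <|
    imp (c.cAct g == w.tab 7 0 (cType w 1 x) % (c.maxAction + 1)) <|
      cWin w (cType w 1 (cStep w x g)) &&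
      cDesc w 1 (c.cPri w x g) (cType w 1 x) (cType w 1 (cStep w x g))

/-- The certificate describes a winning strategy of Nature. -/
def cEnvWins : Bool :=
  cWin w (cType w 1 (cInit w)) &&
  ball (w.1 + 1) fun x => ball (c.maxAction + 1) fun a =>
    imp (cWin w (cType w 1 x)) <|
      cType w 1 (w.tab 8 (cType w 1 x) a % (w.1 + 1)) == cType w 1 x &&
      (c.cAct (w.tab 9 (cType w 1 x) a % (c.maxMove + 1)) == a &&
      (cWin w (cType w 1 (cStep w (w.tab 8 (cType w 1 x) a % (w.1 + 1))
        (w.tab 9 (cType w 1 x) a % (c.maxMove + 1)))) &&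
      cDesc w 0 (c.cPri w (w.tab 8 (cType w 1 x) a % (w.1 + 1))
        (w.tab 9 (cType w 1 x) a % (c.maxMove + 1))) (cType w 1 x)
        (cType w 1 (cStep w (w.tab 8 (cType w 1 x) a % (w.1 + 1))
          (w.tab 9 (cType w 1 x) a % (c.maxMove + 1))))))

variable {c w}

theorem cStep_eq (x : Fin (w.1 + 1)) (g : Fin (c.maxMove + 1)) :
    cStep w x g = (((c.abs w).step x g : Fin (w.1 + 1)) : ℕ) := rfl

theorem cInit_eq : cInit w = (((c.abs w).init : Fin (w.1 + 1)) : ℕ) := rfl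

theorem cType_eq (J : Set (Fin (c.observers + 1))) (x : Fin (w.1 + 1)) :
    cType w (setCode J) x = (c.abs w).type J x := rfl

theorem cType_one (x : Fin (w.1 + 1)) : cType w 1 x = (c.abs w).pos x := by
  change _ = w.tab 4 (setCode {0}) x
  rw [setCode_zero]
  rfl

theorem cOb_eq (x : Fin (w.1 + 1)) (g : Fin (c.maxMove + 1)) (i : Fin (c.observers + 1)) :
    c.cOb w x g i = (c.game.ob ((c.abs w).key x) g i : ℕ) := rfl

theorem cPri_eq (x : Fin (w.1 + 1)) (g : Fin (c.maxMove + 1)) :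
    c.cPri w x g = c.game.pri ((c.abs w).key x) g := rfl

theorem cAct_eq (g : Fin (c.maxMove + 1)) : c.cAct g = (c.game.act g : ℕ) := rfl

theorem cSub_iff {n : ℕ} {J K : Set (Fin (n + 1))} :
    cSub n (setCode J) (setCode K) = true ↔ J ⊆ K := by
  simp only [cSub, ball_fin_iff, imp_iff, memCode_setCode]
  rfl

theorem cClosed_iff {x : Fin (w.1 + 1)} {g : Fin (c.maxMove + 1)} {K : Set (Fin (c.observers + 1))} :
    c.cClosed w x g (setCode K) = true ↔ ∀ i ∈ K, ∀ k,
      c.game.link (c.game.ob ((c.abs w).key x) g i) i k → k ∈ K := by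
  simp only [cClosed, ball_fin_iff, imp_iff, Bool.and_eq_true, memCode_setCode, and_imp]
  refine forall_congr' fun i => ⟨fun h hi k hk => h k hi ?_, fun h k hi hk => h hi k ?_⟩
  · exact List.contains_iff_mem.2 hk
  · exact List.contains_iff_mem.1 hk

/-- The closure is characterised as the least closed superset, which replaces reachability by a
bounded quantifier over sets. -/
theorem cNext_iff {x : Fin (w.1 + 1)} {g : Fin (c.maxMove + 1)}
    {J K : Set (Fin (c.observers + 1))} :
    c.cNext w (setCode J) x g (setCode K) = true ↔ K = (c.abs w).next J x g := by
  simp only [cNext, Bool.and_eq_true, cSub_iff, cClosed_iff, ballSet_iff, imp_iff, and_imp]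
  constructor
  · rintro ⟨⟨h1, h2⟩, h3⟩
    exact (h3 _ (Game.subset_cl _ _) fun i hi k hk => Game.cl_closed hi hk).antisymm
      (Game.cl_subset h1 h2)
  · rintro rfl
    exact ⟨⟨Game.subset_cl _ _, fun i hi k hk => Game.cl_closed hi hk⟩, fun K' => Game.cl_subset⟩

theorem cAgree_iff {x y : Fin (w.1 + 1)} {g d : Fin (c.maxMove + 1)}
    {K : Set (Fin (c.observers + 1))} :
    c.cAgree w (setCode K) x g y d = true ↔ (c.abs w).Agree K x g y d := by
  simp only [cAgree, ball_fin_iff, imp_iff, memCode_setCode, beq_iff_eq, cOb_eq, Fin.val_inj]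
  rfl

theorem cEquiv_iff {x y : Fin (w.1 + 1)} {J : Set (Fin (c.observers + 1))} :
    c.cEquiv w (setCode J) x y = true ↔ (c.abs w).Equiv J x y := by
  simp only [cEquiv, Bool.and_eq_true, ball_fin_iff, ballSet_iff, imp_iff, cSub_iff, beq_iff_eq,
    cType_eq]
  refine and_congr ?_ Iff.rfl
  constructor
  · rintro ⟨h1, h2⟩
    exact Prod.ext (funext fun i => Fin.ext (h1 i)) (Fin.ext h2)
  · intro h
    exact ⟨fun i => congrArg Fin.val (congrFun (congrArg Prod.fst h) i),
      congrArg Fin.val (congrArg Prod.snd h)⟩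

theorem cKeys_iff : c.cKeys w = true ↔ (c.abs w).key (c.abs w).init = c.game.jrun [] ∧
    ∀ x g, (c.abs w).key ((c.abs w).step x g) = c.game.jstep ((c.abs w).key x) g := by
  simp only [cKeys, Bool.and_eq_true, ball_fin_iff, beq_iff_eq]
  refine and_congr ?_ (forall_congr' fun x => forall_congr' fun g => ?_)
  · constructor
    · rintro ⟨h1, h2⟩
      exact Prod.ext (funext fun i => Fin.ext (h1 i)) (Fin.ext h2)
    · intro h
      exact ⟨fun i => congrArg Fin.val (congrFun (congrArg Prod.fst h) i),
        congrArg Fin.val (congrArg Prod.snd h)⟩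
  · constructor
    · rintro ⟨h1, h2⟩
      exact Prod.ext (funext fun i => Fin.ext (h1 i)) (Fin.ext h2)
    · intro h
      exact ⟨fun i => congrArg Fin.val (congrFun (congrArg Prod.fst h) i),
        congrArg Fin.val (congrArg Prod.snd h)⟩

theorem cForth_iff : c.cForth w = true ↔ ∀ J x g y d,
    (c.abs w).Agree ((c.abs w).next J x g) x g y d →
    (c.abs w).type ((c.abs w).next J x g) x = (c.abs w).type ((c.abs w).next J x g) y →
    (c.abs w).type J ((c.abs w).step x g) = (c.abs w).type J ((c.abs w).step y d) := by
  simp only [cForth, ball_fin_iff, ballSet_iff, imp_iff, cNext_iff, cAgree_iff, cStep_eq, cType_eq,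
    beq_iff_eq]
  exact forall_congr' fun J => ⟨fun h x g => h _ x g rfl, fun h K x g hK => hK ▸ h x g⟩

theorem cBack_iff : c.cBack w = true ↔ ∀ J x g y,
    (c.abs w).type J ((c.abs w).step x g) = (c.abs w).type J y →
    ∃ z d, (c.abs w).Agree ((c.abs w).next J x g) x g z d ∧
      (c.abs w).type ((c.abs w).next J x g) x = (c.abs w).type ((c.abs w).next J x g) z ∧
      (c.abs w).Equiv J ((c.abs w).step z d) y := by
  simp only [cBack, ball_fin_iff, bex_fin_iff, ballSet_iff, imp_iff, cNext_iff, cAgree_iff, cStep_eq,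
    cType_eq, beq_iff_eq, cEquiv_iff, Bool.and_eq_true]
  exact forall_congr' fun J => ⟨fun h x g => h _ x g rfl, fun h K x g hK => hK ▸ h x g⟩

theorem cBase_iff : c.cBase w = true ↔ ∀ J y,
    (c.abs w).type J (c.abs w).init = (c.abs w).type J y → (c.abs w).Equiv J (c.abs w).init y := by
  simp only [cBase, ball_fin_iff, ballSet_iff, imp_iff, cInit_eq (c := c), cType_eq, beq_iff_eq,
    cEquiv_iff]

theorem cCongr_iff : c.cCongr w = true ↔ ∀ J x y g, (c.abs w).Equiv ((c.abs w).next J x g) x y →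
    (c.abs w).Equiv J ((c.abs w).step x g) ((c.abs w).step y g) := by
  simp only [cCongr, ball_fin_iff, ballSet_iff, imp_iff, cNext_iff, cStep_eq, cEquiv_iff]
  exact forall_congr' fun J => ⟨fun h x y g => h _ x g rfl y, fun h K x g hK y => hK ▸ h x y g⟩

theorem foldl_cStep (τ : List ℕ) :
    τ.foldl (fun y g => cStep w y (g % (c.maxMove + 1))) (cInit w) =
      (((c.abs w).run (τ.map (Fin.ofNat (c.maxMove + 1))) : Fin (w.1 + 1)) : ℕ) := by
  induction τ using List.reverseRecOn with
  | nil => rfl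
  | append_singleton τ g ih =>
    rw [List.foldl_append, ih, List.map_append]
    exact (congrArg Fin.val (Game.Abstraction.run_append (c.abs w) _ (Fin.ofNat _ g))).symm

theorem valid_of_cValid (h : c.cValid w = true) : (c.abs w).Valid := by
  simp only [cValid, Bool.and_eq_true, cKeys_iff, cForth_iff, cBack_iff, cBase_iff, cCongr_iff] at h
  obtain ⟨⟨h1, h2⟩, h3, h4, h5, h6, h7⟩ := h
  refine ⟨h1, h2, h3, h4, h5, h6, fun x => ?_⟩
  simp only [cReach, ball_fin_iff, beq_iff_eq, foldl_cStep] at h7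
  exact ⟨_, Fin.ext (h7 x)⟩

theorem cValid_of_valid (h : (c.abs w).Valid)
    (hw : ∀ x : Fin (w.1 + 1),
      (c.abs w).run ((w.2.1.getD x []).map (Fin.ofNat (c.maxMove + 1))) = x) :
    c.cValid w = true := by
  simp only [cValid, Bool.and_eq_true, cKeys_iff, cForth_iff, cBack_iff, cBase_iff, cCongr_iff]
  refine ⟨⟨h.key_init, h.key_step⟩, h.forth, h.back, h.base, h.congr, ?_⟩
  simp only [cReach, ball_fin_iff, beq_iff_eq, foldl_cStep]
  exact fun x => congrArg Fin.val (hw x)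

theorem cActVis_iff : c.cActVis w = true ↔ (c.abs w).ActVis := by
  simp only [cActVis, ball_fin_iff, imp_iff, beq_iff_eq, cAct_eq, Fin.val_inj]
  refine forall_congr' fun x => forall_congr' fun g => forall_congr' fun y => forall_congr' fun d => ?_
  have := cOb_eq x g 0
  have h' := cOb_eq y d 0
  simp only [Fin.val_zero] at this h'
  rw [this, h', Fin.val_inj]

theorem cColVis_iff : c.cColVis w = true ↔ (c.abs w).ColVis := by
  have hnext : ∀ (x : Fin (w.1 + 1)) (g : Fin (c.maxMove + 1)) (K : Set (Fin (c.observers + 1))),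
      c.cNext w 1 x g (setCode K) = true ↔ K = (c.abs w).next {0} x g := fun x g K => by
    rw [← cNext_iff, setCode_zero]
  simp only [cColVis, ball_fin_iff, imp_iff, beq_iff_eq, ballSet_iff, cAgree_iff, cType_eq, cPri_eq,
    hnext]
  exact ⟨fun h x g => h _ x g rfl, fun h K x g hK => hK ▸ h x g⟩

theorem cDesc_iff {b m k k' : ℕ} : cDesc w b m k k' = true ↔ Descends b m (w.tab 6) k k' := by
  simp only [cDesc, ball_iff, imp_iff, beq_iff_eq, Bool.and_eq_true, decide_eq_true_eq,
    Nat.lt_succ_iff, Descends]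
  exact forall_congr' fun p => ⟨fun h h1 h2 => h h2 h1, fun h h1 h2 => h h2 h1⟩

theorem cSysWins_iff : c.cSysWins w = true ↔ (c.abs w).SysWins (fun k => cWin w k = true)
    (fun k => Fin.ofNat (c.maxAction + 1) (w.tab 7 0 k)) (w.tab 6) := by
  simp only [cSysWins, ball_fin_iff, imp_iff, beq_iff_eq, Bool.and_eq_true, cDesc_iff, cStep_eq,
    cInit_eq (c := c), cType_one (c := c), cPri_eq, cAct_eq, Game.Abstraction.SysWins, Fin.ext_iff]
  rfl

theorem cEnvWins_iff : c.cEnvWins w = true ↔ (c.abs w).EnvWins (fun k => cWin w k = true)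
    (fun k a => Fin.ofNat (w.1 + 1) (w.tab 8 k a)) (fun k a => Fin.ofNat (c.maxMove + 1) (w.tab 9 k a))
    (w.tab 6) := by
  have h1 : ∀ y, y % (w.1 + 1) = ((Fin.ofNat (w.1 + 1) y : Fin (w.1 + 1)) : ℕ) := fun _ => rfl
  have h2 : ∀ y, y % (c.maxMove + 1) = ((Fin.ofNat (c.maxMove + 1) y : Fin (c.maxMove + 1)) : ℕ) :=
    fun _ => rfl
  simp only [cEnvWins, ball_fin_iff, imp_iff, beq_iff_eq, Bool.and_eq_true, cDesc_iff, h1, h2,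
    cStep_eq, cInit_eq (c := c), cType_one (c := c), cPri_eq, cAct_eq, Game.Abstraction.EnvWins,
    Fin.val_inj]

end GameCode

-- Primitive recursiveness of the checks, assembled by `fun_prop`.

attribute [fun_prop] Primrec Primrec.id Primrec.const Primrec.comp Primrec.pair Primrec.fst
  Primrec.snd Primrec.succ

section

variable {α β : Type*} [Primcodable α] [Primcodable β]

@[fun_prop]
theorem primrec_add {f g : α → ℕ} (hf : Primrec f) (hg : Primrec g) : Primrec fun a => f a + g a :=
  Primrec.nat_add.comp hf hg

@[fun_prop]
theorem primrec_mod {f g : α → ℕ} (hf : Primrec f) (hg : Primrec g) : Primrec fun a => f a % g a :=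
  Primrec.nat_mod.comp hf hg

@[fun_prop]
theorem primrec_div {f g : α → ℕ} (hf : Primrec f) (hg : Primrec g) : Primrec fun a => f a / g a :=
  Primrec.nat_div.comp hf hg

@[fun_prop]
theorem primrec_two_pow {f : α → ℕ} (hf : Primrec f) : Primrec fun a => 2 ^ f a := by
  have h : Primrec fun a => (f a).rec (motive := fun _ => ℕ) 1 fun _ m => m + m :=
    Primrec.nat_rec' hf (.const 1) (by fun_prop : Primrec fun p : α × ℕ × ℕ => p.2.2 + p.2.2).to₂
  refine h.of_eq fun a => ?_
  induction f a with
  | zero => rfl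
  | succ k ih => rw [pow_succ, ← ih, mul_two]

@[fun_prop]
theorem primrec_beq {f g : α → ℕ} (hf : Primrec f) (hg : Primrec g) :
    Primrec fun a => f a == g a :=
  Primrec.beq.comp hf hg

@[fun_prop]
theorem primrec_le {f g : α → ℕ} (hf : Primrec f) (hg : Primrec g) :
    Primrec fun a => decide (f a ≤ g a) :=
  Primrec.nat_le.decide.comp hf hg

@[fun_prop]
theorem primrec_lt {f g : α → ℕ} (hf : Primrec f) (hg : Primrec g) :
    Primrec fun a => decide (f a < g a) :=
  Primrec.nat_lt.decide.comp hf hg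

@[fun_prop]
theorem primrec_and {f g : α → Bool} (hf : Primrec f) (hg : Primrec g) :
    Primrec fun a => f a && g a :=
  Primrec.and.comp hf hg

@[fun_prop]
theorem primrec_or {f g : α → Bool} (hf : Primrec f) (hg : Primrec g) :
    Primrec fun a => f a || g a :=
  Primrec.or.comp hf hg

@[fun_prop]
theorem primrec_not {f : α → Bool} (hf : Primrec f) : Primrec fun a => !f a :=
  Primrec.not.comp hf

@[fun_prop]
theorem primrec_imp {f g : α → Bool} (hf : Primrec f) (hg : Primrec g) :
    Primrec fun a => imp (f a) (g a) := by
  unfold imp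
  fun_prop

@[fun_prop]
theorem primrec_getD {f : α → List β} {g : α → ℕ} {d : β} (hf : Primrec f) (hg : Primrec g) :
    Primrec fun a => (f a).getD (g a) d :=
  (Primrec.list_getD d).comp hf hg

theorem list_any_eq_foldr {γ : Type*} (l : List γ) (f : γ → Bool) :
    l.any f = l.foldr (fun x b => f x || b) false := by
  induction l <;> simp_all

@[fun_prop]
theorem primrec_any {f : α → List β} {g : α → β → Bool} (hf : Primrec f)
    (hg : Primrec fun p : α × β => g p.1 p.2) : Primrec fun a => (f a).any (g a) := by
  simp only [list_any_eq_foldr]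
  exact Primrec.list_foldr hf (.const false)
    (by fun_prop : Primrec fun p : α × β × Bool => g p.1 p.2.1 || p.2.2).to₂

@[fun_prop]
theorem primrec_bex {n : α → ℕ} {f : α → ℕ → Bool} (hn : Primrec n)
    (hf : Primrec fun p : α × ℕ => f p.1 p.2) : Primrec fun a => bex (n a) (f a) :=
  primrec_any (Primrec.list_range.comp hn) hf

@[fun_prop]
theorem primrec_ball {n : α → ℕ} {f : α → ℕ → Bool} (hn : Primrec n)
    (hf : Primrec fun p : α × ℕ => f p.1 p.2) : Primrec fun a => ball (n a) (f a) := by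
  have h : Primrec fun a => !bex (n a) fun x => !f a x := by fun_prop
  refine h.of_eq fun a => ?_
  simp [ball, bex, List.not_any_eq_all_not]

@[fun_prop]
theorem primrec_ballSet {n : α → ℕ} {f : α → ℕ → Bool} (hn : Primrec n)
    (hf : Primrec fun p : α × ℕ => f p.1 p.2) : Primrec fun a => ballSet (n a) (f a) := by
  unfold ballSet
  fun_prop

@[fun_prop]
theorem primrec_foldl {f : α → List β} {g : α → ℕ} {h : α → ℕ → β → ℕ} (hf : Primrec f)
    (hg : Primrec g) (hh : Primrec fun p : α × ℕ × β => h p.1 p.2.1 p.2.2) :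
    Primrec fun a => (f a).foldl (h a) (g a) :=
  Primrec.list_foldl hf hg hh.to₂

@[fun_prop]
theorem primrec_contains {f : α → List (ℕ × ℕ × ℕ)} {g : α → ℕ × ℕ × ℕ} (hf : Primrec f)
    (hg : Primrec g) : Primrec fun a => (f a).contains (g a) := by
  have h : Primrec fun a => (f a).any fun x => decide (g a = x) :=
    primrec_any hf (Primrec.eq.decide.comp (hg.comp .fst) .snd)
  refine h.of_eq fun a => ?_
  rw [Bool.eq_iff_iff, List.any_eq_true, List.contains_iff_mem]
  simp

@[fun_prop]
theorem primrec_memCode {f g : α → ℕ} (hf : Primrec f) (hg : Primrec g) :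
    Primrec fun a => memCode (f a) (g a) := by
  unfold memCode
  fun_prop

@[fun_prop]
theorem primrec_tab {w : α → Cert} {f g h : α → ℕ} (hw : Primrec w) (hf : Primrec f)
    (hg : Primrec g) (hh : Primrec h) : Primrec fun a => (w a).tab (f a) (g a) (h a) := by
  unfold Cert.tab
  fun_prop

theorem primrec_mealyCodeEquiv : Primrec mealyCodeEquiv := Primrec.of_equiv

theorem primrec_gameCodeEquiv : Primrec gameCodeEquiv := Primrec.of_equiv

@[fun_prop]
theorem primrec_maxState {M : α → MealyCode} (hM : Primrec M) : Primrec fun a => (M a).maxState :=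
  Primrec.fst.comp (primrec_mealyCodeEquiv.comp hM)

@[fun_prop]
theorem primrec_init {M : α → MealyCode} (hM : Primrec M) : Primrec fun a => (M a).init :=
  (Primrec.fst.comp .snd).comp (primrec_mealyCodeEquiv.comp hM)

@[fun_prop]
theorem primrec_table {M : α → MealyCode} (hM : Primrec M) : Primrec fun a => (M a).table :=
  (Primrec.snd.comp .snd).comp (primrec_mealyCodeEquiv.comp hM)

@[fun_prop]
theorem primrec_entry {M : α → MealyCode} {f g : α → ℕ} (hM : Primrec M) (hf : Primrec f)
    (hg : Primrec g) : Primrec fun a => (M a).entry (f a) (g a) := by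
  unfold MealyCode.entry
  fun_prop

@[fun_prop]
theorem primrec_observers {c : α → GameCode} (hc : Primrec c) : Primrec fun a => (c a).observers :=
  (by fun_prop : Primrec fun p : (ℕ × ℕ × ℕ × ℕ) × List ℕ × List MealyCode × List (ℕ × ℕ × ℕ) ×
    MealyCode => p.1.1).comp (primrec_gameCodeEquiv.comp hc)

@[fun_prop]
theorem primrec_maxAction {c : α → GameCode} (hc : Primrec c) : Primrec fun a => (c a).maxAction :=
  (by fun_prop : Primrec fun p : (ℕ × ℕ × ℕ × ℕ) × List ℕ × List MealyCode × List (ℕ × ℕ × ℕ) ×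
    MealyCode => p.1.2.1).comp (primrec_gameCodeEquiv.comp hc)

@[fun_prop]
theorem primrec_maxMove {c : α → GameCode} (hc : Primrec c) : Primrec fun a => (c a).maxMove :=
  (by fun_prop : Primrec fun p : (ℕ × ℕ × ℕ × ℕ) × List ℕ × List MealyCode × List (ℕ × ℕ × ℕ) ×
    MealyCode => p.1.2.2.1).comp (primrec_gameCodeEquiv.comp hc)

@[fun_prop]
theorem primrec_maxObs {c : α → GameCode} (hc : Primrec c) : Primrec fun a => (c a).maxObs :=
  (by fun_prop : Primrec fun p : (ℕ × ℕ × ℕ × ℕ) × List ℕ × List MealyCode × List (ℕ × ℕ × ℕ) ×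
    MealyCode => p.1.2.2.2).comp (primrec_gameCodeEquiv.comp hc)

@[fun_prop]
theorem primrec_act {c : α → GameCode} (hc : Primrec c) : Primrec fun a => (c a).act :=
  (by fun_prop : Primrec fun p : (ℕ × ℕ × ℕ × ℕ) × List ℕ × List MealyCode × List (ℕ × ℕ × ℕ) ×
    MealyCode => p.2.1).comp (primrec_gameCodeEquiv.comp hc)

@[fun_prop]
theorem primrec_obs {c : α → GameCode} (hc : Primrec c) : Primrec fun a => (c a).obs :=
  (by fun_prop : Primrec fun p : (ℕ × ℕ × ℕ × ℕ) × List ℕ × List MealyCode × List (ℕ × ℕ × ℕ) ×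
    MealyCode => p.2.2.1).comp (primrec_gameCodeEquiv.comp hc)

@[fun_prop]
theorem primrec_links {c : α → GameCode} (hc : Primrec c) : Primrec fun a => (c a).links :=
  (by fun_prop : Primrec fun p : (ℕ × ℕ × ℕ × ℕ) × List ℕ × List MealyCode × List (ℕ × ℕ × ℕ) ×
    MealyCode => p.2.2.2.1).comp (primrec_gameCodeEquiv.comp hc)

@[fun_prop]
theorem primrec_color {c : α → GameCode} (hc : Primrec c) : Primrec fun a => (c a).color :=
  (by fun_prop : Primrec fun p : (ℕ × ℕ × ℕ × ℕ) × List ℕ × List MealyCode × List (ℕ × ℕ × ℕ) ×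
    MealyCode => p.2.2.2.2).comp (primrec_gameCodeEquiv.comp hc)

namespace GameCode

variable {c : α → GameCode} {w : α → Cert} {i J K x y g d : α → ℕ}

@[fun_prop]
theorem primrec_mealy (hc : Primrec c) (hi : Primrec i) : Primrec fun a => (c a).mealy (i a) := by
  unfold mealy
  fun_prop

@[fun_prop]
theorem primrec_cInit (hw : Primrec w) : Primrec fun a => cInit (w a) := by
  unfold cInit
  fun_prop

@[fun_prop]
theorem primrec_cStep (hw : Primrec w) (hx : Primrec x) (hg : Primrec g) :
    Primrec fun a => cStep (w a) (x a) (g a) := by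
  unfold cStep
  fun_prop

@[fun_prop]
theorem primrec_cState (hc : Primrec c) (hw : Primrec w) (hi : Primrec i) (hx : Primrec x) :
    Primrec fun a => (c a).cState (w a) (i a) (x a) := by
  unfold cState
  fun_prop

@[fun_prop]
theorem primrec_cColor (hc : Primrec c) (hw : Primrec w) (hx : Primrec x) :
    Primrec fun a => (c a).cColor (w a) (x a) := by
  unfold cColor
  fun_prop

@[fun_prop]
theorem primrec_cType (hw : Primrec w) (hJ : Primrec J) (hx : Primrec x) :
    Primrec fun a => cType (w a) (J a) (x a) := by
  unfold cType
  fun_prop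

@[fun_prop]
theorem primrec_cOb (hc : Primrec c) (hw : Primrec w) (hx : Primrec x) (hg : Primrec g)
    (hi : Primrec i) : Primrec fun a => (c a).cOb (w a) (x a) (g a) (i a) := by
  unfold cOb
  fun_prop

@[fun_prop]
theorem primrec_cPri (hc : Primrec c) (hw : Primrec w) (hx : Primrec x) (hg : Primrec g) :
    Primrec fun a => (c a).cPri (w a) (x a) (g a) := by
  unfold cPri
  fun_prop

@[fun_prop]
theorem primrec_cAct (hc : Primrec c) (hg : Primrec g) : Primrec fun a => (c a).cAct (g a) := by
  unfold cAct
  fun_prop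

@[fun_prop]
theorem primrec_cSub (hi : Primrec i) (hJ : Primrec J) (hK : Primrec K) :
    Primrec fun a => cSub (i a) (J a) (K a) := by
  unfold cSub
  fun_prop

@[fun_prop]
theorem primrec_cClosed (hc : Primrec c) (hw : Primrec w) (hx : Primrec x) (hg : Primrec g)
    (hK : Primrec K) : Primrec fun a => (c a).cClosed (w a) (x a) (g a) (K a) := by
  unfold cClosed
  fun_prop

@[fun_prop]
theorem primrec_cNext (hc : Primrec c) (hw : Primrec w) (hJ : Primrec J) (hx : Primrec x)
    (hg : Primrec g) (hK : Primrec K) :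
    Primrec fun a => (c a).cNext (w a) (J a) (x a) (g a) (K a) := by
  unfold cNext
  fun_prop

@[fun_prop]
theorem primrec_cAgree (hc : Primrec c) (hw : Primrec w) (hK : Primrec K) (hx : Primrec x)
    (hg : Primrec g) (hy : Primrec y) (hd : Primrec d) :
    Primrec fun a => (c a).cAgree (w a) (K a) (x a) (g a) (y a) (d a) := by
  unfold cAgree
  fun_prop

@[fun_prop]
theorem primrec_cEquiv (hc : Primrec c) (hw : Primrec w) (hJ : Primrec J) (hx : Primrec x)
    (hy : Primrec y) : Primrec fun a => (c a).cEquiv (w a) (J a) (x a) (y a) := by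
  unfold cEquiv
  fun_prop

@[fun_prop]
theorem primrec_cKeys (hc : Primrec c) (hw : Primrec w) : Primrec fun a => (c a).cKeys (w a) := by
  unfold cKeys
  fun_prop

@[fun_prop]
theorem primrec_cForth (hc : Primrec c) (hw : Primrec w) : Primrec fun a => (c a).cForth (w a) := by
  unfold cForth
  fun_prop

@[fun_prop]
theorem primrec_cBack (hc : Primrec c) (hw : Primrec w) : Primrec fun a => (c a).cBack (w a) := by
  unfold cBack
  fun_prop

@[fun_prop]
theorem primrec_cBase (hc : Primrec c) (hw : Primrec w) : Primrec fun a => (c a).cBase (w a) := by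
  unfold cBase
  fun_prop

@[fun_prop]
theorem primrec_cCongr (hc : Primrec c) (hw : Primrec w) : Primrec fun a => (c a).cCongr (w a) := by
  unfold cCongr
  fun_prop

@[fun_prop]
theorem primrec_cReach (hc : Primrec c) (hw : Primrec w) : Primrec fun a => (c a).cReach (w a) := by
  unfold cReach
  fun_prop

@[fun_prop]
theorem primrec_cValid (hc : Primrec c) (hw : Primrec w) : Primrec fun a => (c a).cValid (w a) := by
  unfold cValid
  fun_prop

@[fun_prop]
theorem primrec_cActVis (hc : Primrec c) (hw : Primrec w) :
    Primrec fun a => (c a).cActVis (w a) := by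
  unfold cActVis
  fun_prop

@[fun_prop]
theorem primrec_cColVis (hc : Primrec c) (hw : Primrec w) :
    Primrec fun a => (c a).cColVis (w a) := by
  unfold cColVis
  fun_prop

@[fun_prop]
theorem primrec_cWin (hw : Primrec w) (hx : Primrec x) : Primrec fun a => cWin (w a) (x a) := by
  unfold cWin
  fun_prop

@[fun_prop]
theorem primrec_cDesc (hw : Primrec w) (hi : Primrec i) (hg : Primrec g) (hx : Primrec x)
    (hy : Primrec y) : Primrec fun a => cDesc (w a) (i a) (g a) (x a) (y a) := by
  unfold cDesc
  fun_prop

@[fun_prop]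
theorem primrec_cSysWins (hc : Primrec c) (hw : Primrec w) :
    Primrec fun a => (c a).cSysWins (w a) := by
  unfold cSysWins
  fun_prop

@[fun_prop]
theorem primrec_cEnvWins (hc : Primrec c) (hw : Primrec w) :
    Primrec fun a => (c a).cEnvWins (w a) := by
  unfold cEnvWins
  fun_prop

end GameCode

end

/-! ### Soundness and completeness of certificates. -/

theorem exists_rows (F : ℕ → ℕ → ℕ) (B : ℕ) :
    ∃ T : List (List ℕ), ∀ i < B, ∀ j < B, (T.getD i []).getD j 0 = F i j := by
  refine ⟨(List.range B).map fun i => (List.range B).map (F i), fun i hi j hj => ?_⟩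
  simp [hi, hj]

theorem Cert.exists_tab (F : ℕ → ℕ → ℕ → ℕ) (m B : ℕ) :
    ∃ T : List (List (List ℕ)), ∀ N l, ∀ k < m, ∀ i < B, ∀ j < B,
      Cert.tab (N, l, T) k i j = F k i j := by
  choose T hT using fun k => exists_rows (F k) B
  refine ⟨(List.range m).map T, fun N l k hk i hi j hj => ?_⟩
  rw [← hT k i hi j hj]
  simp [Cert.tab, hk]

namespace Game.Abstraction

variable {n : ℕ} {A Γ S : Type} {G : Game n A Γ S} {X : Type} {D : Abstraction G X}

/-- A finite table reproduces a strategy and its ranks only on a bounded range; positions of states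
and ranks up to the occurring priorities are all that matters. -/
theorem SysWins.congr {W W' : ℕ → Prop} {σ σ' : ℕ → A} {r r' : ℕ → ℕ → ℕ} (h : D.SysWins W σ r)
    (hW : ∀ x, W (D.pos x) ↔ W' (D.pos x)) (hσ : ∀ x, σ (D.pos x) = σ' (D.pos x))
    (hr : ∀ x c y p, p ≤ G.pri (D.key x) c → r p (D.pos y) = r' p (D.pos y)) :
    D.SysWins W' σ' r' := by
  refine ⟨(hW _).1 h.1, fun x c hx hc => ?_⟩
  obtain ⟨h1, h2⟩ := h.2 x c ((hW _).2 hx) (hc.trans (hσ x).symm)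
  refine ⟨(hW _).1 h1, fun p hp hpc => ?_⟩
  rw [← hr x c _ p hpc, ← hr x c _ p hpc]
  exact h2 p hp hpc

theorem EnvWins.congr {W W' : ℕ → Prop} {y y' : ℕ → A → X} {d d' : ℕ → A → Γ} {r r' : ℕ → ℕ → ℕ}
    (h : D.EnvWins W y d r) (hW : ∀ x, W (D.pos x) ↔ W' (D.pos x))
    (hy : ∀ x, y (D.pos x) = y' (D.pos x)) (hd : ∀ x, d (D.pos x) = d' (D.pos x))
    (hr : ∀ x c z p, p ≤ G.pri (D.key x) c → r p (D.pos z) = r' p (D.pos z)) :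
    D.EnvWins W' y' d' r' := by
  refine ⟨(hW _).1 h.1, fun x a hx => ?_⟩
  obtain ⟨h1, h2, h3, h4⟩ := h.2 x a ((hW _).2 hx)
  rw [← hy, ← hd]
  refine ⟨h1, h2, (hW _).1 h3, fun p hp hpc => ?_⟩
  rw [← hr _ _ _ p hpc, ← hr _ _ _ p hpc]
  exact h4 p hp hpc

end Game.Abstraction

namespace GameCode

/-- The certificate proves that the active player wins a visible game. -/
def cYes (c : GameCode) (w : Cert) : Bool :=
  c.cValid w && (c.cActVis w && (c.cColVis w && c.cSysWins w))

/-- The certificate proves that the game is not visible or that Nature wins. -/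
def cNo (c : GameCode) (w : Cert) : Bool :=
  c.cValid w && (!c.cActVis w || (!c.cColVis w || c.cEnvWins w))

theorem cYes_sound {c : GameCode} {w : Cert} (h : c.cYes w = true) :
    c.IsVisibleFIPGame ∧ c.game.HasWinningStrategy := by
  simp only [cYes, Bool.and_eq_true] at h
  obtain ⟨h1, h2, h3, h4⟩ := h
  have hD := valid_of_cValid h1
  exact ⟨⟨hD.actionVisible_iff.2 (cActVis_iff.1 h2), hD.colorVisible_iff.2 (cColVis_iff.1 h3)⟩,
    (cSysWins_iff.1 h4).hasWinningStrategy hD⟩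

theorem cNo_sound {c : GameCode} {w : Cert} (h : c.cNo w = true) :
    ¬ (c.IsVisibleFIPGame ∧ c.game.HasWinningStrategy) := by
  simp only [cNo, Bool.and_eq_true, Bool.or_eq_true, Bool.not_eq_true', ← Bool.not_eq_true] at h
  obtain ⟨h1, h2⟩ := h
  have hD := valid_of_cValid h1
  rintro ⟨⟨hA, hC⟩, hs⟩
  rcases h2 with h2 | h2 | h2
  · exact h2 (cActVis_iff.2 (hD.actionVisible_iff.1 hA))
  · exact h2 (cColVis_iff.2 (hD.colorVisible_iff.1 hC))
  · exact (cEnvWins_iff.1 h2).not_hasWinningStrategy hD hA hC hs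

/-- Every valid abstraction is described by a certificate whose remaining tables are arbitrary. -/
theorem exists_cert (c : GameCode) {N : ℕ} {D : c.game.Abstraction (Fin (N + 1))} (hD : D.Valid)
    (E : ℕ → ℕ → ℕ → ℕ) (B : ℕ) : ∃ l T, c.abs (N, l, T) = D ∧ c.cValid (N, l, T) = true ∧
      ∀ k, 5 ≤ k → k < 10 → ∀ i < B, ∀ j < B, Cert.tab (N, l, T) k i j = E k i j := by
  let F : ℕ → ℕ → ℕ → ℕ := fun k i j =>
    match k with
    | 0 => (D.init : ℕ)
    | 1 => (D.step (Fin.ofNat (N + 1) i) (Fin.ofNat (c.maxMove + 1) j) : ℕ)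
    | 2 => ((D.key (Fin.ofNat (N + 1) j)).1 (Fin.ofNat (c.observers + 1) i) :
        Fin ((c.mealy (Fin.ofNat (c.observers + 1) i : Fin (c.observers + 1))).maxState + 1)).val
    | 3 => ((D.key (Fin.ofNat (N + 1) j)).2 : Fin (c.color.maxState + 1)).val
    | 4 => D.type {p | memCode i p = true} (Fin.ofNat (N + 1) j)
    | k + 5 => E (k + 5) i j
  obtain ⟨B', h1, h2, h3, h4, h5⟩ : ∃ B', B ≤ B' ∧ N + 1 ≤ B' ∧ c.maxMove + 1 ≤ B' ∧
      c.observers + 1 ≤ B' ∧ 2 ^ (c.observers + 1) ≤ B' :=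
    ⟨max B (max (N + 1) (max (c.maxMove + 1) (max (c.observers + 1) (2 ^ (c.observers + 1))))),
      by simp, by simp, by simp, by simp, by simp⟩
  obtain ⟨T, hT⟩ := Cert.exists_tab F 10 B'
  choose τ hτ using hD.reachable
  let l : List (List ℕ) := List.ofFn fun x => (τ x).map Fin.val
  have habs : c.abs (N, l, T) = D := by
    refine Game.Abstraction.ext ?_ ?_ ?_ ?_
    · refine Fin.ext ?_
      change Cert.tab (N, l, T) 0 0 0 % (N + 1) = _
      rw [hT N l 0 (by omega) 0 (by omega) 0 (by omega)]
      exact Nat.mod_eq_of_lt D.init.2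
    · funext x g
      refine Fin.ext ?_
      change Cert.tab (N, l, T) 1 x g % (N + 1) = _
      rw [hT N l 1 (by omega) x (by omega) g (by omega)]
      simp only [F, Fin.ofNat_val_eq_self]
      exact Nat.mod_eq_of_lt (D.step x g).2
    · funext x
      refine Prod.ext (funext fun i => Fin.ext ?_) (Fin.ext ?_)
      · change Cert.tab (N, l, T) 2 i x % ((c.mealy i).maxState + 1) = _
        rw [hT N l 2 (by omega) i (by omega) x (by omega)]
        -- The state set depends on the player, so the index can be rewritten only after passing to
        -- the underlying numbers.
        have hi : ∀ i', i' = i → ((D.key x).1 i' : Fin ((c.mealy i').maxState + 1)).val =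
            ((D.key x).1 i : Fin ((c.mealy i).maxState + 1)).val := by
          rintro _ rfl
          rfl
        simp only [F, Fin.ofNat_val_eq_self x]
        rw [hi _ (Fin.ofNat_val_eq_self i)]
        exact Nat.mod_eq_of_lt (Fin.isLt (n := (c.mealy i).maxState + 1) _)
      · change Cert.tab (N, l, T) 3 0 x % (c.color.maxState + 1) = _
        rw [hT N l 3 (by omega) 0 (by omega) x (by omega)]
        simp only [F, Fin.ofNat_val_eq_self]
        exact Nat.mod_eq_of_lt (Fin.isLt (n := c.color.maxState + 1) _)
    · funext J x
      change Cert.tab (N, l, T) 4 (setCode J) x = _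
      rw [hT N l 4 (by omega) _ ((setCode_lt J).trans_le h5) x (by omega)]
      simp only [F, Fin.ofNat_val_eq_self, memCode_setCode]
      rfl
  refine ⟨l, T, habs, cValid_of_valid (habs ▸ hD) fun x => ?_, fun k hk hk' i hi j hj => ?_⟩
  · rw [habs]
    refine Eq.trans ?_ (hτ x)
    congr 1
    change (l.getD x []).map _ = _
    rw [getD_ofFn]
    simp [Function.comp_def]
  · rw [hT N l k hk' i (by omega) j (by omega)]
    obtain ⟨k, rfl⟩ := Nat.exists_eq_add_of_le' hk
    rfl

theorem exists_cYes_or_cNo (c : GameCode) : ∃ w, c.cYes w = true ∨ c.cNo w = true := by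
  classical
  obtain ⟨N, D, hD⟩ := c.game.exists_abstraction
  obtain ⟨B₁, hB₁⟩ := (Set.finite_range D.pos).bddAbove
  obtain ⟨B₂, hB₂⟩ := (Set.finite_range fun z : Fin (N + 1) × Fin (c.maxMove + 1) =>
    c.game.pri (D.key z.1) z.2).bddAbove
  replace hB₁ : ∀ x, D.pos x ≤ B₁ := fun x => hB₁ ⟨x, rfl⟩
  replace hB₂ : ∀ x g, c.game.pri (D.key x) g ≤ B₂ := fun x g => hB₂ ⟨(x, g), rfl⟩
  -- Table indices are positions (at most `B₁`), priorities (at most `B₂`) and actions, so all of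
  -- them lie below `B`.
  let B := B₁ + B₂ + c.maxAction + 1
  rcases D.exists_positional_strategy with ⟨W, σ, r, h⟩ | ⟨W, y, d, r, h⟩
  · let E : ℕ → ℕ → ℕ → ℕ := fun k i j =>
      match k with
      | 5 => if W j then 1 else 0
      | 6 => r i j
      | 7 => (σ j : ℕ)
      | _ => 0
    obtain ⟨l, T, habs, hval, hT⟩ := c.exists_cert hD E B
    have h1 : c.cSysWins (N, l, T) = true := by
      rw [cSysWins_iff, habs]
      refine h.congr (fun x => ?_) (fun x => ?_) fun x g z p hp => ?_
      · have := hB₁ x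
        rw [cWin, hT 5 (by omega) (by omega) 0 (by omega) _ (by omega)]
        simp [E]
      · have := hB₁ x
        change _ = Fin.ofNat _ (Cert.tab _ 7 0 _)
        rw [hT 7 (by omega) (by omega) 0 (by omega) _ (by omega)]
        simp [E]
      · have := hB₁ z
        have := hB₂ x g
        rw [hT 6 (by omega) (by omega) _ (by omega) _ (by omega)]
        rfl
    refine ⟨(N, l, T), ?_⟩
    simp only [cYes, cNo, hval, h1]
    -- If a visibility check fails, the same certificate is a negative one.
    cases c.cActVis (N, l, T) <;> cases c.cColVis (N, l, T) <;> simp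
  · let E : ℕ → ℕ → ℕ → ℕ := fun k i j =>
      match k with
      | 5 => if W j then 1 else 0
      | 6 => r i j
      | 8 => (y i (Fin.ofNat (c.maxAction + 1) j) : ℕ)
      | 9 => (d i (Fin.ofNat (c.maxAction + 1) j) : ℕ)
      | _ => 0
    obtain ⟨l, T, habs, hval, hT⟩ := c.exists_cert hD E B
    have h1 : c.cEnvWins (N, l, T) = true := by
      rw [cEnvWins_iff, habs]
      refine h.congr (fun x => ?_) (fun x => funext fun a => ?_) (fun x => funext fun a => ?_)
        fun x g z p hp => ?_
      · have := hB₁ x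
        rw [cWin, hT 5 (by omega) (by omega) 0 (by omega) _ (by omega)]
        simp [E]
      · have := hB₁ x
        change _ = Fin.ofNat _ (Cert.tab _ 8 _ _)
        rw [hT 8 (by omega) (by omega) _ (by omega) _ (by omega)]
        simp [E]
      · have := hB₁ x
        change _ = Fin.ofNat _ (Cert.tab _ 9 _ _)
        rw [hT 9 (by omega) (by omega) _ (by omega) _ (by omega)]
        simp [E]
      · have := hB₁ z
        have := hB₂ x g
        rw [hT 6 (by omega) (by omega) _ (by omega) _ (by omega)]
        rfl
    refine ⟨(N, l, T), .inr ?_⟩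
    simp [cNo, hval, h1]

theorem primrec_cYes {α : Type*} [Primcodable α] {c : α → GameCode} {w : α → Cert} (hc : Primrec c)
    (hw : Primrec w) : Primrec fun a => (c a).cYes (w a) := by
  unfold cYes
  fun_prop

theorem primrec_cNo {α : Type*} [Primcodable α] {c : α → GameCode} {w : α → Cert} (hc : Primrec c)
    (hw : Primrec w) : Primrec fun a => (c a).cNo (w a) := by
  unfold cNo
  fun_prop

end GameCode

/-- A predicate is decidable if its instances and its counterexamples have certificates that can be
checked by algorithms. -/
theorem computablePred_of_certificates {α β : Type*} [Primcodable α] [Primcodable β] {p : α → Prop}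
    {yes no : α → β → Bool} (hyes : Computable₂ yes) (hno : Computable₂ no)
    (h1 : ∀ a b, yes a b = true → p a) (h2 : ∀ a b, no a b = true → ¬ p a)
    (h3 : ∀ a, ∃ b, yes a b = true ∨ no a b = true) : ComputablePred p := by
  classical
  have hre : ∀ {f : α → β → Bool}, Computable₂ f → REPred fun a => ∃ b, f a b = true := by
    intro f hf
    -- Search through all natural numbers, read as encoded certificates.
    let g : α → ℕ → Option Unit := fun a n =>
      (Encodable.decode (α := β) n).bind fun b => bif f a b then some () else none
    have hg : Computable₂ g := Computable.option_bind (Computable.decode.comp .snd)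
      (Computable.cond (hf.comp (Computable.fst.comp .fst) .snd) (.const _) (.const _)).to₂
    refine (Partrec.rfindOpt hg).dom_re.of_eq fun a => ?_
    rw [Nat.rfindOpt_dom]
    simp only [g, Option.mem_def, Option.bind_eq_some_iff]
    constructor
    · rintro ⟨n, u, b, -, hb⟩
      cases h : f a b
      · simp [h] at hb
      · exact ⟨b, h⟩
    · rintro ⟨b, hb⟩
      exact ⟨Encodable.encode b, (), b, Encodable.encodek b, by simp [hb]⟩
  refine ComputablePred.computable_iff_re_compl_re.2 ⟨(hre hyes).of_eq fun a => ?_,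
    (hre hno).of_eq fun a => ?_⟩
  · refine ⟨fun ⟨b, hb⟩ => h1 a b hb, fun hp => ?_⟩
    obtain ⟨b, hb | hb⟩ := h3 a
    exacts [⟨b, hb⟩, (h2 a b hb hp).elim]
  · refine ⟨fun ⟨b, hb⟩ => h2 a b hb, fun hp => ?_⟩
    obtain ⟨b, hb | hb⟩ := h3 a
    exacts [(hp (h1 a b hb)).elim, ⟨b, hb⟩]

end FIP

/-- The synthesis problem for FIP games with a visible parity winning condition is decidable: it is
decidable whether a given code describes such a game in which Player `0` has a winning strategy. -/
theorem mainTheorem1 :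
    ComputablePred fun c : FIP.GameCode =>
      c.IsVisibleFIPGame ∧ c.game.HasWinningStrategy :=
  FIP.computablePred_of_certificates (yes := FIP.GameCode.cYes) (no := FIP.GameCode.cNo)
    (FIP.GameCode.primrec_cYes .fst .snd).to_comp (FIP.GameCode.primrec_cNo .fst .snd).to_comp
    (fun _ _ => FIP.GameCode.cYes_sound) (fun _ _ => FIP.GameCode.cNo_sound)
    FIP.GameCode.exists_cYes_or_cNo
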